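/- **Setting.** Let $\mathbb{R}^{4,2}$ be $\mathbb{R}^6$ with an inner product $(\cdot,\cdot)$ of signature $(-++++-)$. Let $\mathfrak p\in\mathbb{R}^{4,2}$ with $(\mathfrak p,\mathfrak p)=-1$ and let $\mathfrak q\neq 0$ with $(\mathfrak p,\mathfrak q)=0$. The set $$\mathcal Q=\{x : (x,x)=0,\ (x,\mathfrak p)=0,\ (x,\mathfrak q)=-1\}$$ is a model of the 3-dimensional space form of curvature $\kappa=-(\mathfrak q,\mathfrak q)$ (each connected component of $\mathcal Q$ is one). Its isometries are the orthogonal transformations of $\mathbb{R}^{4,2}$ that fix $\mathfrak p$ and $\mathfrak q$, and $\mathcal T=\{x : (x,x)=0,\ (x,\mathfrak p)=-1,\ (x,\mathfrak q)=0\}$ is its set of oriented planes. **Surfaces.** A surface in $\mathcal Q$ is a smooth map $\mathfrak f:\Sigma\to\mathcal Q$ of a connected smooth 2-manifold $\Sigma$ together with its tangent plane congruence, a smooth map $\mathfrak t:\Sigma\to\mathcal T$ with $(\mathfrak f,\mathfrak t)=0$ and $(d\mathfrak f,\mathfrak t)=0$, such that $\Lambda=\langle\mathfrak f,\mathfrak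 t\rangle$ is a Legendre immersion: $d\mathfrak f(X),d\mathfrak t(X)\in\Lambda$ only for $X=0$. (The map $\mathfrak f$ may have singularities; every immersion $\mathfrak f$ with a tangent plane congruence is included.) A curvature sphere at a point $x$ is a line $\langle\sigma\rangle\subset\Lambda(x)$ for which there is a tangent vector $X\ne0$ such that the sections of $\Lambda$ through $\sigma$ have $X$-derivative in $\Lambda(x)$. The surface is assumed to be umbilic-free: it has two distinct curvature spheres $\langle\sigma_1\rangle,\langle\sigma_2\rangle$ at every point. Its principal curvatures are $k_i=(\sigma_i,\mathfrak q)/(\sigma_i,\mathfrak p)$, and $K=k_1k_2$, $H=\frac12(k_1+k_2)$. The surface is *non-tubular linear Weingarten* if there are real constants $a,b,c$ with $ac-b^2\ne0$ and $aK+2bH+c=0$. At singularities of $\mathfrak f$, where some $(\sigma_i,\mathfrak p)=0$, the equation is read after multiplication by $(\sigma_1,\mathfrak p)(\sigma_2,\mathfrak p)$. It is a *channel surface* if $\Lambda$ envelops a smooth one-parameter family of spheres: there are lines $s(x)\subset\Lambda(x)$, $x\in\Sigma$, which locally are of the form $s(x)=\langle\sigma(u(x))\rangle$ with a smooth real function $u$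 and a smooth nowhere vanishing curve $\sigma$ in $\mathbb{R}^{4,2}$. A *subgroup of rotations* in a 2-plane $\Pi\perp\langle\mathfrak p,\mathfrak q\rangle$ is a nontrivial continuous one-parameter group $\rho$ of isometries of $\mathcal Q$ that act as the identity on $\Pi^\perp$. It is elliptic, parabolic or hyperbolic if the induced metric on $\Pi$ has signature $(++)$, $(+0)$ or $(+-)$, respectively. **Theorem.** Every umbilic-free non-tubular channel linear Weingarten surface $(\mathfrak f,\mathfrak t)$ in a space form $\mathcal Q$ is a rotational surface: there are a 2-plane $\Pi\perp\langle\mathfrak p,\mathfrak q\rangle$ and a subgroup $\rho$ of rotations in $\Pi$, which is elliptic, parabolic or hyperbolic, such that the surface is invariant under $\rho$. That is, around every point of $\Sigma$ there are local coordinates $(r,\theta)$, a profile curve $\mathfrak c$ in $\mathcal Q$ that is orthogonal to a unit vector of $\Pi$, and a curve $\nu$ in $\mathcal T$ with $$\mathfrak f(r,\theta)=\rho(\theta)\,\mathfrak c(r),\qquad \mathfrak t(r,\theta)=\rho(\theta)\,\nu(r).$$ The plane $\Pi$ and the subgroup $\rho$ are the same for all points of $\Sigma$. -/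

import Mathlib

open Set
open scoped Manifold ContDiff

/-- The underlying vector space of `ℝ^{4,2}`. -/
abbrev LieVec : Type := Fin 6 → ℝ

/-- The inner product of signature `(-++++-)` on `ℝ^{4,2}`. -/
noncomputable def lieForm : LinearMap.BilinForm ℝ LieVec :=
  Matrix.toBilin' (Matrix.diagonal ![-1, 1, 1, 1, 1, -1])

theorem lieForm_apply (x y : LieVec) :
    lieForm x y = -(x 0 * y 0) + x 1 * y 1 + x 2 * y 2 + x 3 * y 3 + x 4 * y 4 - x 5 * y 5 := by
  simp [lieForm, Matrix.toBilin'_apply, Matrix.diagonal_apply, Fin.sum_univ_succ]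
  ring

/-- The space form with point sphere complex `p` and space form vector `q`; its curvature is
`-(q, q)`. Its elements are lightlike vectors, they are nonzero as `(x, q) = -1`. -/
def spaceForm (p q : LieVec) : Set LieVec :=
  {x | lieForm x x = 0 ∧ lieForm x p = 0 ∧ lieForm x q = -1}

/-- The space of (oriented) planes of the space form `spaceForm p q`. -/
def planeSpace (p q : LieVec) : Set LieVec :=
  {x | lieForm x x = 0 ∧ lieForm x p = -1 ∧ lieForm x q = 0}

/-- The isometries of the space form: orthogonal transformations of `ℝ^{4,2}` that fix `p` and
`q`. (Invertibility follows, because the form is nondegenerate.) -/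
def IsSpaceFormIsometry (p q : LieVec) (A : LieVec →L[ℝ] LieVec) : Prop :=
  (∀ x y, lieForm (A x) (A y) = lieForm x y) ∧ A p = p ∧ A q = q

section Surfaces

variable {S : Type*} [TopologicalSpace S] [ChartedSpace (EuclideanSpace ℝ (Fin 2)) S]

/-- The differential at `x` of a map from a surface to `ℝ^{4,2}`, in the direction of `X`. -/
noncomputable def lieDiff (g : S → LieVec) (x : S) (X : TangentSpace (𝓡 2) x) : LieVec :=
  mfderiv (𝓡 2) 𝓘(ℝ, LieVec) g x X

/-- The line congruence spanned by `f` and `t`. -/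
def legendreLift (f t : S → LieVec) (x : S) : Submodule ℝ LieVec :=
  Submodule.span ℝ {f x, t x}

/-- `f` is a surface in the space form, with tangent plane congruence `t`: both are smooth, and
`⟨f, t⟩` is a Legendre immersion. The map `f` itself may have singularities; if it is an
immersion, then the last field holds automatically. -/
structure IsSpaceFormSurface (p q : LieVec) (f t : S → LieVec) : Prop where
  smooth_f : ContMDiff (𝓡 2) 𝓘(ℝ, LieVec) ∞ f
  smooth_t : ContMDiff (𝓡 2) 𝓘(ℝ, LieVec) ∞ t
  mem_f : ∀ x, f x ∈ spaceForm p q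
  mem_t : ∀ x, t x ∈ planeSpace p q
  incident : ∀ x, lieForm (f x) (t x) = 0
  contact : ∀ x X, lieForm (lieDiff f x X) (t x) = 0
  immersion : ∀ x X, lieDiff f x X ∈ legendreLift f t x →
    lieDiff t x X ∈ legendreLift f t x → X = 0

/-- The vector `σ` spans a curvature sphere of `⟨f, t⟩` at `x`, with curvature direction `X`:
sections of `⟨f, t⟩` through `σ` have `X`-derivative in `⟨f, t⟩`. For a section `α f + β t` with
functions `α`, `β`, the derivatives of `α` and `β` contribute elements of `⟨f, t⟩` only,
and so do not matter. -/
def IsCurvatureSphere (f t : S → LieVec) (x : S) (σ : LieVec) : Prop :=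
  σ ≠ 0 ∧ ∃ α β : ℝ, σ = α • f x + β • t x ∧
    ∃ X : TangentSpace (𝓡 2) x, X ≠ 0 ∧
      α • lieDiff f x X + β • lieDiff t x X ∈ legendreLift f t x

/-- There are no umbilics: at every point there are two distinct curvature spheres. -/
def UmbilicFree (f t : S → LieVec) : Prop :=
  ∀ x, ∃ σ₁ σ₂, IsCurvatureSphere f t x σ₁ ∧ IsCurvatureSphere f t x σ₂ ∧
    LinearIndependent ℝ ![σ₁, σ₂]

/-- The principal curvature `(σ, q) / (σ, p)` that belongs to a curvature sphere `σ`
(finite if `(σ, p) ≠ 0`). -/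
noncomputable def principalCurvature (p q σ : LieVec) : ℝ :=
  lieForm σ q / lieForm σ p

/-- The linear Weingarten condition `a K + 2 b H + c = 0`, where `K = k₁ k₂` and
`2 H = k₁ + k₂` for the principal curvatures `kᵢ = (σᵢ, q) / (σᵢ, p)`. It is multiplied by
`(σ₁, p) (σ₂, p)`, so that it makes sense at the singularities of `f` too, where a principal
curvature is infinite; see `weingarten_iff` and `IsCurvatureSphere.form_ne_zero`. -/
def SatisfiesWeingarten (p q : LieVec) (f t : S → LieVec) (a b c : ℝ) : Prop :=
  ∀ x σ₁ σ₂, IsCurvatureSphere f t x σ₁ → IsCurvatureSphere f t x σ₂ →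
    LinearIndependent ℝ ![σ₁, σ₂] →
    a * (lieForm σ₁ q * lieForm σ₂ q)
      + b * (lieForm σ₁ q * lieForm σ₂ p + lieForm σ₁ p * lieForm σ₂ q)
      + c * (lieForm σ₁ p * lieForm σ₂ p) = 0

theorem weingarten_iff (p q σ₁ σ₂ : LieVec) (a b c K H : ℝ)
    (h₁ : lieForm σ₁ p ≠ 0) (h₂ : lieForm σ₂ p ≠ 0)
    (hK : K = principalCurvature p q σ₁ * principalCurvature p q σ₂)
    (hH : H = (principalCurvature p q σ₁ + principalCurvature p q σ₂) / 2) :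
    a * (lieForm σ₁ q * lieForm σ₂ q)
      + b * (lieForm σ₁ q * lieForm σ₂ p + lieForm σ₁ p * lieForm σ₂ q)
      + c * (lieForm σ₁ p * lieForm σ₂ p) = 0 ↔ a * K + 2 * b * H + c = 0 := by
  have key : a * (lieForm σ₁ q * lieForm σ₂ q)
      + b * (lieForm σ₁ q * lieForm σ₂ p + lieForm σ₁ p * lieForm σ₂ q)
      + c * (lieForm σ₁ p * lieForm σ₂ p)
      = (lieForm σ₁ p * lieForm σ₂ p) * (a * K + 2 * b * H + c) := by
    rw [hK, hH, principalCurvature, principalCurvature]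
    field_simp
  rw [key, mul_eq_zero]
  exact ⟨fun h => h.resolve_left (mul_ne_zero h₁ h₂), Or.inr⟩

/-- `f` is linear Weingarten and not tubular, that is, `a c - b² ≠ 0`. -/
def IsNonTubularLinearWeingarten (p q : LieVec) (f t : S → LieVec) : Prop :=
  ∃ a b c : ℝ, a * c - b ^ 2 ≠ 0 ∧ SatisfiesWeingarten p q f t a b c

/-- `f` is a channel surface: `⟨f, t⟩` envelops a sphere congruence `s` that locally is a smooth
one-parameter family `⟨σ(u)⟩` of spheres, where `u` is a smooth real function on the surface. -/
def IsChannel (f t : S → LieVec) : Prop :=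
  ∃ s : S → Submodule ℝ LieVec, (∀ x, s x ≤ legendreLift f t x) ∧
    ∀ x, ∃ (U : Set S) (I : Set ℝ) (u : S → ℝ) (σ : ℝ → LieVec),
      IsOpen U ∧ x ∈ U ∧ IsOpen I ∧ MapsTo u U I ∧
      ContMDiffOn (𝓡 2) 𝓘(ℝ, ℝ) ∞ u U ∧ ContDiffOn ℝ ∞ σ I ∧ (∀ τ ∈ I, σ τ ≠ 0) ∧
      ∀ y ∈ U, s y = Submodule.span ℝ {σ (u y)}

end Surfaces

/-- `ρ` is a (nontrivial) one-parameter subgroup of rotations in the 2-plane `P ⊥ ⟨p, q⟩`: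
a one-parameter group of isometries of the space form that act as the identity on `P^⊥`. -/
structure IsRotationSubgroup (p q : LieVec) (P : Submodule ℝ LieVec)
    (ρ : ℝ → LieVec →L[ℝ] LieVec) : Prop where
  finrank_eq : Module.finrank ℝ P = 2
  perp_p : ∀ x ∈ P, lieForm x p = 0
  perp_q : ∀ x ∈ P, lieForm x q = 0
  continuous : Continuous ρ
  map_zero : ρ 0 = ContinuousLinearMap.id ℝ LieVec
  map_add : ∀ θ η, ρ (θ + η) = (ρ θ).comp (ρ η)
  isometry : ∀ θ, IsSpaceFormIsometry p q (ρ θ)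
  fixes_orthogonal : ∀ θ x, (∀ y ∈ P, lieForm x y = 0) → ρ θ x = x
  nontrivial : ∃ θ, ρ θ ≠ ContinuousLinearMap.id ℝ LieVec

/-- The induced metric on the 2-plane `P` has signature `(++)`. -/
def IsEllipticPlane (P : Submodule ℝ LieVec) : Prop :=
  ∃ e v : LieVec, P = Submodule.span ℝ {e, v} ∧ lieForm e e = 1 ∧ lieForm e v = 0 ∧
    0 < lieForm v v

/-- The induced metric on the 2-plane `P` has signature `(+0)`. -/
def IsParabolicPlane (P : Submodule ℝ LieVec) : Prop :=
  ∃ e v : LieVec, P = Submodule.span ℝ {e, v} ∧ lieForm e e = 1 ∧ lieForm e v = 0 ∧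
    lieForm v v = 0

/-- The induced metric on the 2-plane `P` has signature `(+-)`. -/
def IsHyperbolicPlane (P : Submodule ℝ LieVec) : Prop :=
  ∃ e v : LieVec, P = Submodule.span ℝ {e, v} ∧ lieForm e e = 1 ∧ lieForm e v = 0 ∧
    lieForm v v < 0

section Rotational

variable {S : Type*} [TopologicalSpace S] [ChartedSpace (EuclideanSpace ℝ (Fin 2)) S]

/-- `f`, with its tangent plane congruence `t`, is invariant under the subgroup `ρ` of rotations
in `P`: around every point there are local coordinates `(r, θ)` of the surface in which
`f = ρ(θ) c(r)` and `t = ρ(θ) ν(r)`. Here `c` is a profile curve in the space form that is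
planar, that is, orthogonal to a unit vector of `P`. -/
def IsInvariantUnder (p q : LieVec) (P : Submodule ℝ LieVec) (ρ : ℝ → LieVec →L[ℝ] LieVec)
    (f t : S → LieVec) : Prop :=
  ∀ x : S, ∃ (Φ : PartialDiffeomorph 𝓘(ℝ, ℝ × ℝ) (𝓡 2) (ℝ × ℝ) S ∞) (r₀ r₁ θ₀ θ₁ : ℝ)
    (c ν : ℝ → LieVec) (e : LieVec),
    Φ.source = Ioo r₀ r₁ ×ˢ Ioo θ₀ θ₁ ∧ x ∈ Φ.target ∧
    e ∈ P ∧ lieForm e e = 1 ∧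
    (∀ r ∈ Ioo r₀ r₁, c r ∈ spaceForm p q ∧ ν r ∈ planeSpace p q ∧ lieForm (c r) e = 0) ∧
    ∀ r ∈ Ioo r₀ r₁, ∀ θ ∈ Ioo θ₀ θ₁,
      f (Φ (r, θ)) = ρ θ (c r) ∧ t (Φ (r, θ)) = ρ θ (ν r)

/-- `f` is a rotational surface: it is invariant under one subgroup of rotations, which is
elliptic, parabolic or hyperbolic. -/
def IsRotationalSurface (p q : LieVec) (f t : S → LieVec) : Prop :=
  ∃ (P : Submodule ℝ LieVec) (ρ : ℝ → LieVec →L[ℝ] LieVec),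
    IsRotationSubgroup p q P ρ ∧
    (IsEllipticPlane P ∨ IsParabolicPlane P ∨ IsHyperbolicPlane P) ∧
    IsInvariantUnder p q P ρ f t

/-- The differential of `g` is orthogonal to every vector with which `g` has constant product. -/
theorem lieForm_lieDiff_eq_zero {g : S → LieVec} (hg : ContMDiff (𝓡 2) 𝓘(ℝ, LieVec) ∞ g)
    {w : LieVec} {k : ℝ} (hk : ∀ y, lieForm (g y) w = k) (x : S) (X : TangentSpace (𝓡 2) x) :
    lieForm (lieDiff g x X) w = 0 := by
  let l : LieVec →L[ℝ] ℝ := LinearMap.toContinuousLinearMap (lieForm.flip w)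
  have hd : HasMFDerivAt (𝓡 2) 𝓘(ℝ, LieVec) g x (mfderiv (𝓡 2) 𝓘(ℝ, LieVec) g x) :=
    (hg.mdifferentiable (by simp) x).hasMFDerivAt
  have hl : HasMFDerivAt 𝓘(ℝ, LieVec) 𝓘(ℝ, ℝ) l (g x) l := l.hasMFDerivAt
  have hc := hl.comp x hd
  have he : (l ∘ g) = fun _ => k := by
    funext y
    exact hk y
  rw [he] at hc
  have h0 := hasMFDerivAt_unique hc (hasMFDerivAt_const k x)
  exact congrArg (fun m => m X) h0

/-- At a point where `f` is immersed, the principal curvatures are finite. -/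
theorem IsCurvatureSphere.form_ne_zero {p q : LieVec} {f t : S → LieVec}
    (h : IsSpaceFormSurface p q f t) {x : S} {σ : LieVec} (hσ : IsCurvatureSphere f t x σ)
    (hf : ∀ X : TangentSpace (𝓡 2) x, lieDiff f x X = 0 → X = 0) : lieForm σ p ≠ 0 := by
  obtain ⟨h0, α, β, rfl, X, hX, hmem⟩ := hσ
  intro hz
  have hβ : β = 0 := by
    simpa [(h.mem_f x).2.1, (h.mem_t x).2.1] using hz
  subst hβ
  have hα : α ≠ 0 := by
    rintro rfl
    exact h0 (by simp)
  apply hX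
  apply hf
  obtain ⟨m, n, hmn⟩ := Submodule.mem_span_pair.mp hmem
  have hp := congrArg (fun z => lieForm z p) hmn
  have hq := congrArg (fun z => lieForm z q) hmn
  have dp := lieForm_lieDiff_eq_zero h.smooth_f (fun y => (h.mem_f y).2.1) x X
  have dq := lieForm_lieDiff_eq_zero h.smooth_f (fun y => (h.mem_f y).2.2) x X
  simp [(h.mem_f x).2.1, (h.mem_t x).2.1, dp] at hp
  simp [(h.mem_f x).2.2, (h.mem_t x).2.2, dq] at hq
  subst hp hq
  simpa [hα, eq_comm] using hmn

end Rotational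

/-!
A channel linear Weingarten surface is shown to be rotational by differentiating its two curvature
spheres in suitable coordinates `(u, v)`.

Let the surface envelop the spheres `σ(u)`. Differentiation along a level curve of `u` shows that
`σ₁ = σ(u)` is a curvature sphere, and there is no critical point of `u`, since `σ₁` would be the
only curvature sphere there (`fderiv_ne_zero_of_channel`). So `u` is completed to coordinates
`(u, v)`. In `σ₁ = a₁ f + b₁ t` the coefficients are products of `σ(u)` with `q` and `p` and depend
on `u` only. The Weingarten condition says that the two curvature spheres are conjugate with
respect to a quadratic form with constant coefficients on the pencil `⟨f, t⟩`. This form is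
nondegenerate because the surface is not tubular, so the second curvature sphere
`σ₂ = a₂ f + b₂ t` has coefficients that depend on `u` only as well (`channelChart_of_family`).

Let `ω = ∂σ₂/∂v`, the tangent direction of the circular curvature lines. As the coefficients of
`σ₂` do not depend on `v`, and `∂σ₂/∂u` is a multiple of `ω` modulo `⟨f, t⟩`, interchanging the
partial derivatives shows that `∂ω/∂u` lies in `⟨ω, ∂ω/∂v⟩` (`ChannelChart.dirDeriv_ω`). This plane
is the orthogonal complement of `p`, `q`, `σ₁`, `∂σ₁/∂u` (`ChannelChart.mem_span_of_perp`), and so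
contains all derivatives of `ω` and `∂ω/∂v`; hence it is locally constant
(`ChannelChart.eventually_span_eq`). It is the only 2-plane that is orthogonal to `p`, `q` and all
nearby spheres of the channel family (`isAxisPlane_iff`), and therefore one and the same plane `P`
on the connected surface.

`P` contains the spacelike vector `ω`, so it is spanned by a unit vector `e` and an orthogonal
vector `v`, whose sign distinguishes the elliptic, parabolic and hyperbolic cases. All three are
treated at once with the infinitesimal rotation `A = e ∧ v` and the group `exp (θ A)`. As `A`
annihilates `σ₁` and is skew, `A f` and `A t` are the same multiple of `∂f/∂v` and `∂t/∂v`
(`ChannelChart.exists_rotGen_eq`). Thus a reparametrisation `θ` of the `v`-curves, found by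
integrating `1 / (1 + (v, v) m²)` with respect to the tangent `m` of the rotation angle, turns these
curves into orbits `exp (θ A) c(u)` (`ChannelChart.exists_angle_function`,
`exists_rotational_coordinates`).
-/

open scoped Topology

/-! ### Linear algebra of `ℝ^{4,2}` -/

theorem lieForm_comm (x y : LieVec) : lieForm x y = lieForm y x := by
  rw [lieForm_apply, lieForm_apply]; ring

theorem eq_zero_of_forall_lieForm_eq_zero {y : LieVec} (h : ∀ x, lieForm y x = 0) : y = 0 := by
  funext i
  have := h (Pi.single i 1)
  rw [lieForm_apply] at this
  fin_cases i <;> simpa using this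

/-- The orthogonal complement of two orthonormal timelike vectors is positive definite. -/
theorem eq_zero_of_perp_timelike {p n y : LieVec} (hp : lieForm p p = -1) (hn : lieForm n n = -1)
    (hpn : lieForm p n = 0) (hyp : lieForm y p = 0) (hyn : lieForm y n = 0)
    (hy : lieForm y y ≤ 0) : y = 0 := by
  -- A vector without components along the negative coordinates `0` and `5` is not timelike.
  have key : ∀ x : LieVec, x 0 = 0 → x 5 = 0 →
      lieForm x x = x 1 ^ 2 + x 2 ^ 2 + x 3 ^ 2 + x 4 ^ 2 := by
    intro x h0 h5
    rw [lieForm_apply, h0, h5]; ring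
  have expand : ∀ a b c : ℝ, lieForm (a • p + b • n + c • y) (a • p + b • n + c • y)
      = -a ^ 2 - b ^ 2 + c ^ 2 * lieForm y y := by
    intro a b c
    simp only [map_add, map_smul, LinearMap.add_apply, LinearMap.smul_apply, smul_eq_mul, hp, hn,
      hpn, hyp, hyn, lieForm_comm n p, lieForm_comm p y, lieForm_comm n y]
    ring
  have hc : p 0 * n 5 - p 5 * n 0 ≠ 0 := by
    intro hc
    have h1 := expand (n 0) (-p 0) 0
    rw [key _ (by simp; ring) (by simp; linarith)] at h1
    have h2 := expand (n 5) (-p 5) 0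
    rw [key _ (by simp; linarith) (by simp; ring)] at h2
    have hp0 : p 0 = 0 := by
      by_contra h
      nlinarith [sq_nonneg (n 0), pow_pos (abs_pos.2 h) 2, sq_abs (p 0),
        sq_nonneg ((n 0 • p + -p 0 • n + (0 : ℝ) • y) 1),
        sq_nonneg ((n 0 • p + -p 0 • n + (0 : ℝ) • y) 2),
        sq_nonneg ((n 0 • p + -p 0 • n + (0 : ℝ) • y) 3),
        sq_nonneg ((n 0 • p + -p 0 • n + (0 : ℝ) • y) 4)]
    have hp5 : p 5 = 0 := by
      by_contra h
      nlinarith [sq_nonneg (n 5), pow_pos (abs_pos.2 h) 2, sq_abs (p 5),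
        sq_nonneg ((n 5 • p + -p 5 • n + (0 : ℝ) • y) 1),
        sq_nonneg ((n 5 • p + -p 5 • n + (0 : ℝ) • y) 2),
        sq_nonneg ((n 5 • p + -p 5 • n + (0 : ℝ) • y) 3),
        sq_nonneg ((n 5 • p + -p 5 • n + (0 : ℝ) • y) 4)]
    have := key p hp0 hp5
    nlinarith [sq_nonneg (p 1), sq_nonneg (p 2), sq_nonneg (p 3), sq_nonneg (p 4)]
  set a := n 0 * y 5 - n 5 * y 0 with ha
  set b := y 0 * p 5 - y 5 * p 0 with hb
  set c := p 0 * n 5 - p 5 * n 0 with hc'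
  have hx := expand a b c
  have hx0 : (a • p + b • n + c • y) 0 = 0 := by
    simp only [Pi.add_apply, Pi.smul_apply, smul_eq_mul, ha, hb, hc']; ring
  have hx5 : (a • p + b • n + c • y) 5 = 0 := by
    simp only [Pi.add_apply, Pi.smul_apply, smul_eq_mul, ha, hb, hc']; ring
  rw [key _ hx0 hx5] at hx
  set x := a • p + b • n + c • y with hxdef
  have hcy : c ^ 2 * lieForm y y ≤ 0 := mul_nonpos_of_nonneg_of_nonpos (sq_nonneg c) hy
  have ha0 : a = 0 := by
    refine pow_eq_zero_iff (two_ne_zero) |>.1 (le_antisymm ?_ (sq_nonneg a))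
    linarith [sq_nonneg (x 1), sq_nonneg (x 2), sq_nonneg (x 3), sq_nonneg (x 4), sq_nonneg b]
  have hb0 : b = 0 := by
    refine pow_eq_zero_iff (two_ne_zero) |>.1 (le_antisymm ?_ (sq_nonneg b))
    linarith [sq_nonneg (x 1), sq_nonneg (x 2), sq_nonneg (x 3), sq_nonneg (x 4), sq_nonneg a]
  have hz : ∀ z : ℝ, z ^ 2 ≤ 0 → z = 0 := fun z hz =>
    pow_eq_zero_iff (two_ne_zero) |>.1 (le_antisymm hz (sq_nonneg z))
  have hxz : x = 0 := by
    have h1 := sq_nonneg (x 1)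
    have h2 := sq_nonneg (x 2)
    have h3 := sq_nonneg (x 3)
    have h4 := sq_nonneg (x 4)
    have h5 := sq_nonneg a
    have h6 := sq_nonneg b
    have e1 := hz (x 1) (by linarith)
    have e2 := hz (x 2) (by linarith)
    have e3 := hz (x 3) (by linarith)
    have e4 := hz (x 4) (by linarith)
    funext i
    fin_cases i <;> assumption
  rw [hxdef, ha0, hb0, zero_smul, zero_smul, zero_add, zero_add] at hxz
  exact (smul_eq_zero.1 hxz).resolve_left hc

/-- Vectors tangent to a space form are spacelike. -/
theorem lieForm_self_pos_of_perp {p q x y : LieVec} (hp : lieForm p p = -1)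
    (hpq : lieForm p q = 0) (hx : x ∈ spaceForm p q) (hyp : lieForm y p = 0)
    (hyq : lieForm y q = 0) (hyx : lieForm y x = 0) (hy : y ≠ 0) : 0 < lieForm y y := by
  by_contra hle
  obtain ⟨hxx, hxp, hxq⟩ := hx
  -- The vector `q + s x` is timelike for large `s`.
  refine hy (eq_zero_of_perp_timelike (n := q + ((lieForm q q + 1) / 2) • x) hp ?_ ?_ hyp ?_
    (not_lt.1 hle))
  · simp only [map_add, map_smul, LinearMap.add_apply, LinearMap.smul_apply, smul_eq_mul, hxx, hxq,
      lieForm_comm q x]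
    ring
  · simp [hpq, lieForm_comm p x, hxp]
  · simp [hyq, hyx]

/-- The orthogonal complement of an incident point and plane, together with `p` and `q`, has
dimension at most `2`. -/
theorem eq_zero_of_perp_six {p q x t r z y : LieVec} (hp : lieForm p p = -1)
    (hpq : lieForm p q = 0) (hx : x ∈ spaceForm p q) (ht : t ∈ planeSpace p q)
    (hxt : lieForm x t = 0)
    (hr : lieForm r p = 0 ∧ lieForm r q = 0 ∧ lieForm r x = 0 ∧ lieForm r t = 0)
    (hz : lieForm z p = 0 ∧ lieForm z q = 0 ∧ lieForm z x = 0 ∧ lieForm z t = 0)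
    (hy : lieForm y p = 0 ∧ lieForm y q = 0 ∧ lieForm y x = 0 ∧ lieForm y t = 0)
    (hr0 : r ≠ 0) (hz0 : z ≠ 0) (hrz : lieForm r z = 0) (hyr : lieForm y r = 0)
    (hyz : lieForm y z = 0) : y = 0 := by
  have hrr := lieForm_self_pos_of_perp hp hpq hx hr.1 hr.2.1 hr.2.2.1 hr0
  have hzz := lieForm_self_pos_of_perp hp hpq hx hz.1 hz.2.1 hz.2.2.1 hz0
  obtain ⟨hxx, hxp, hxq⟩ := hx
  obtain ⟨htt, htp, htq⟩ := ht
  obtain ⟨hrp, hrq, hrx, hrt⟩ := hr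
  obtain ⟨hzp, hzq, hzx, hzt⟩ := hz
  obtain ⟨hyp, hyq, hyx, hyt⟩ := hy
  have hli : LinearIndependent ℝ ![x, t, p, q, r, z] := by
    rw [Fintype.linearIndependent_iff]
    intro g hg
    simp only [Fin.sum_univ_six, Matrix.cons_val] at hg
    have pair : ∀ w, g 0 * lieForm x w + g 1 * lieForm t w + g 2 * lieForm p w
        + g 3 * lieForm q w + g 4 * lieForm r w + g 5 * lieForm z w = 0 := by
      intro w
      have := congrArg (fun m => lieForm m w) hg
      simpa using this
    have e4 : g 4 = 0 := by
      have := pair r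
      rw [lieForm_comm x r, lieForm_comm t r, lieForm_comm p r, lieForm_comm q r,
        lieForm_comm z r, hrx, hrt, hrp, hrq, hrz] at this
      simpa [hrr.ne'] using this
    have e5 : g 5 = 0 := by
      have := pair z
      rw [lieForm_comm x z, lieForm_comm t z, lieForm_comm p z, lieForm_comm q z,
        hzx, hzt, hzp, hzq, hrz] at this
      simpa [hzz.ne'] using this
    have e3 : g 3 = 0 := by
      have := pair x
      rw [lieForm_comm t x, lieForm_comm p x, lieForm_comm q x, hxx, hxt, hxp, hxq, hrx, hzx]
        at this
      simpa using this
    have e2 : g 2 = 0 := by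
      have := pair t
      rw [lieForm_comm p t, lieForm_comm q t, htt, hxt, htp, htq, hrt, hzt] at this
      simpa using this
    have e1 : g 1 = 0 := by
      have := pair p
      rw [e2, e3, hxp, htp, hrp, hzp] at this
      simpa using this
    have e0 : g 0 = 0 := by
      have := pair q
      rw [e2, e3, hxq, htq, hrq, hzq] at this
      simpa using this
    intro i
    fin_cases i <;> assumption
  have hspan := hli.span_eq_top_of_card_eq_finrank (by simp)
  apply eq_zero_of_forall_lieForm_eq_zero
  intro w
  have hw : w ∈ Submodule.span ℝ (range ![x, t, p, q, r, z]) := hspan ▸ Submodule.mem_top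
  induction hw using Submodule.span_induction with
  | mem w hw =>
    obtain ⟨i, rfl⟩ := hw
    fin_cases i <;> assumption
  | zero => simp
  | add u w _ _ hu hw => simp [hu, hw]
  | smul k w _ hw => simp [hw]

/-! ### Partial derivatives in the plane -/

section Calculus

variable {V : Type*} [NormedAddCommGroup V] [NormedSpace ℝ V]

/-- The derivative of a map on the plane in the direction `w`. -/
noncomputable def dirDeriv (w : ℝ × ℝ) (g : ℝ × ℝ → V) (x : ℝ × ℝ) : V := fderiv ℝ g x w

/-- The partial derivative with respect to the first coordinate. -/
notation "∂₁" => dirDeriv ((1 : ℝ), (0 : ℝ))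

/-- The partial derivative with respect to the second coordinate. -/
notation "∂₂" => dirDeriv ((0 : ℝ), (1 : ℝ))

variable {D : Set (ℝ × ℝ)} {x : ℝ × ℝ} {w w' : ℝ × ℝ}

theorem dirDeriv_eq (w : ℝ × ℝ) (g : ℝ × ℝ → V) (x : ℝ × ℝ) :
    dirDeriv w g x = w.1 • ∂₁ g x + w.2 • ∂₂ g x := by
  have : w = w.1 • ((1 : ℝ), (0 : ℝ)) + w.2 • ((0 : ℝ), (1 : ℝ)) := by ext <;> simp
  conv_lhs => rw [this]
  simp only [dirDeriv, map_add, map_smul]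

theorem ContDiffOn.dirDeriv {g : ℝ × ℝ → V} (hg : ContDiffOn ℝ ∞ g D) (hD : IsOpen D)
    (w : ℝ × ℝ) : ContDiffOn ℝ ∞ (dirDeriv w g) D :=
  (hg.fderiv_of_isOpen hD (m := ∞) (by simp)).clm_apply contDiffOn_const

theorem ContDiffOn.diffAt {g : ℝ × ℝ → V} (hg : ContDiffOn ℝ ∞ g D) (hD : IsOpen D)
    (hx : x ∈ D) : DifferentiableAt ℝ g x :=
  (hg.contDiffAt (hD.mem_nhds hx)).differentiableAt (by simp)

theorem dirDeriv_congr {g h : ℝ × ℝ → V} (hD : IsOpen D) (hgh : EqOn g h D) (hx : x ∈ D) :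
    dirDeriv w g x = dirDeriv w h x := by
  have : g =ᶠ[𝓝 x] h := Filter.eventuallyEq_of_mem (hD.mem_nhds hx) hgh
  rw [dirDeriv, dirDeriv, this.fderiv_eq]

theorem dirDeriv_const (k : V) : dirDeriv w (fun _ => k) x = 0 := by
  simp [dirDeriv]

theorem dirDeriv_add {g h : ℝ × ℝ → V} (hg : DifferentiableAt ℝ g x)
    (hh : DifferentiableAt ℝ h x) :
    dirDeriv w (fun y => g y + h y) x = dirDeriv w g x + dirDeriv w h x := by
  simp [dirDeriv, fderiv_fun_add hg hh]

theorem dirDeriv_smul {a : ℝ × ℝ → ℝ} {g : ℝ × ℝ → V} (ha : DifferentiableAt ℝ a x)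
    (hg : DifferentiableAt ℝ g x) :
    dirDeriv w (fun y => a y • g y) x = dirDeriv w a x • g x + a x • dirDeriv w g x := by
  simp [dirDeriv, fderiv_fun_smul ha hg, add_comm]

theorem dirDeriv_smul_add_smul {a b : ℝ × ℝ → ℝ} {g h : ℝ × ℝ → V} (ha : DifferentiableAt ℝ a x)
    (hb : DifferentiableAt ℝ b x) (hg : DifferentiableAt ℝ g x) (hh : DifferentiableAt ℝ h x) :
    dirDeriv w (fun y => a y • g y + b y • h y) x
      = dirDeriv w a x • g x + a x • dirDeriv w g x
        + (dirDeriv w b x • h x + b x • dirDeriv w h x) := by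
  rw [dirDeriv_add (g := fun y => a y • g y) (h := fun y => b y • h y) (ha.smul hg) (hb.smul hh),
    dirDeriv_smul ha hg, dirDeriv_smul hb hh]

/-- Partial derivatives commute. -/
theorem dirDeriv_comm {g : ℝ × ℝ → V} (hg : ContDiffOn ℝ ∞ g D) (hD : IsOpen D) (hx : x ∈ D) :
    dirDeriv w (dirDeriv w' g) x = dirDeriv w' (dirDeriv w g) x := by
  have hc := hg.contDiffAt (hD.mem_nhds hx)
  have hs := hc.isSymmSndFDerivAt (by
    rw [minSmoothness_of_isRCLikeNormedField]
    exact WithTop.coe_le_coe.2 (le_top : (2 : ℕ∞) ≤ ⊤))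
  have hd : DifferentiableAt ℝ (fderiv ℝ g) x :=
    ((hg.fderiv_of_isOpen hD (m := ∞) (by simp)).contDiffAt (hD.mem_nhds hx)).differentiableAt
      (by simp)
  have key : ∀ v v', dirDeriv v (dirDeriv v' g) x = fderiv ℝ (fderiv ℝ g) x v v' := by
    intro v v'
    have := hd.hasFDerivAt.clm_apply (hasFDerivAt_const v' x)
    unfold dirDeriv
    rw [this.fderiv]
    simp
  rw [key, key]
  exact hs w w'

theorem dirDeriv_comp_fst {φ : ℝ → V} (hφ : DifferentiableAt ℝ φ x.1) :
    ∂₂ (fun y => φ y.1) x = 0 := by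
  have h : HasFDerivAt (fun y : ℝ × ℝ => φ y.1) _ x :=
    hφ.hasFDerivAt.comp x (hasFDerivAt_fst (𝕜 := ℝ) (E := ℝ) (F := ℝ))
  unfold dirDeriv
  rw [h.fderiv]
  simp

end Calculus

section Forms

/-- The inner product of `ℝ^{4,2}` as a continuous bilinear map. -/
noncomputable def lieFormL : LieVec →L[ℝ] LieVec →L[ℝ] ℝ :=
  LinearMap.toContinuousLinearMap
    ((LinearMap.toContinuousLinearMap : (LieVec →ₗ[ℝ] ℝ) ≃ₗ[ℝ] (LieVec →L[ℝ] ℝ)).toLinearMap.comp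
      lieForm)

theorem lieFormL_apply (x y : LieVec) : lieFormL x y = lieForm x y := rfl

variable {D : Set (ℝ × ℝ)} {x : ℝ × ℝ} {w : ℝ × ℝ} {g h : ℝ × ℝ → LieVec}

theorem dirDeriv_lieForm (hg : DifferentiableAt ℝ g x) (hh : DifferentiableAt ℝ h x) :
    dirDeriv w (fun y => lieForm (g y) (h y)) x
      = lieForm (dirDeriv w g x) (h x) + lieForm (g x) (dirDeriv w h x) := by
  have := lieFormL.hasFDerivAt_of_bilinear hg.hasFDerivAt hh.hasFDerivAt
  simp only [lieFormL_apply] at this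
  unfold dirDeriv
  rw [this.fderiv]
  simp [lieFormL_apply, add_comm]

theorem ContDiffOn.lieForm (hg : ContDiffOn ℝ ∞ g D) (hh : ContDiffOn ℝ ∞ h D) :
    ContDiffOn ℝ ∞ (fun y => lieForm (g y) (h y)) D := by
  have h1 : ContDiffOn ℝ ∞ (fun y => lieFormL (g y)) D := lieFormL.contDiff.comp_contDiffOn hg
  exact h1.clm_apply hh

/-- The product rule for two maps with constant inner product. -/
theorem lieForm_dirDeriv_add_eq_zero (hD : IsOpen D) (hg : ContDiffOn ℝ ∞ g D)
    (hh : ContDiffOn ℝ ∞ h D) {k : ℝ} (hk : ∀ y ∈ D, _root_.lieForm (g y) (h y) = k)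
    (hx : x ∈ D) (w : ℝ × ℝ) :
    _root_.lieForm (dirDeriv w g x) (h x) + _root_.lieForm (g x) (dirDeriv w h x) = 0 := by
  rw [← dirDeriv_lieForm (hg.diffAt hD hx) (hh.diffAt hD hx),
    dirDeriv_congr (h := fun _ => k) hD hk hx, dirDeriv_const]

/-- A fixed vector that is orthogonal to a map is orthogonal to its derivative. -/
theorem lieForm_dirDeriv_eq_zero (hD : IsOpen D) (hg : ContDiffOn ℝ ∞ g D) {n : LieVec} {k : ℝ}
    (hk : ∀ y ∈ D, _root_.lieForm (g y) n = k) (hx : x ∈ D) (w : ℝ × ℝ) :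
    _root_.lieForm (dirDeriv w g x) n = 0 := by
  have := lieForm_dirDeriv_add_eq_zero (h := fun _ => n) hD hg contDiffOn_const hk hx w
  simpa [dirDeriv_const] using this

end Forms

/-! ### Planes that are parallel along a planar domain -/

/-- A plane field `⟨A, B⟩` that contains the derivatives of `A` and `B` is locally constant. -/
theorem eventually_span_pair_eq {D : Set (ℝ × ℝ)} {A B : ℝ × ℝ → LieVec} (hD : IsOpen D)
    (hA : ContDiffOn ℝ ∞ A D) (hB : ContDiffOn ℝ ∞ B D)
    (hdA : ∀ x ∈ D, ∀ w, dirDeriv w A x ∈ Submodule.span ℝ {A x, B x})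
    (hdB : ∀ x ∈ D, ∀ w, dirDeriv w B x ∈ Submodule.span ℝ {A x, B x})
    (φ ψ : LieVec →L[ℝ] ℝ) {x₀ : ℝ × ℝ} (hx₀ : x₀ ∈ D)
    (hdet : φ (A x₀) * ψ (B x₀) - φ (B x₀) * ψ (A x₀) ≠ 0) :
    ∀ᶠ x in 𝓝 x₀, Submodule.span ℝ {A x, B x} = Submodule.span ℝ {A x₀, B x₀} := by
  have hφA : ContDiffOn ℝ ∞ (fun x => φ (A x)) D := φ.contDiff.comp_contDiffOn hA
  have hφB : ContDiffOn ℝ ∞ (fun x => φ (B x)) D := φ.contDiff.comp_contDiffOn hB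
  have hψA : ContDiffOn ℝ ∞ (fun x => ψ (A x)) D := ψ.contDiff.comp_contDiffOn hA
  have hψB : ContDiffOn ℝ ∞ (fun x => ψ (B x)) D := ψ.contDiff.comp_contDiffOn hB
  set δ : ℝ × ℝ → ℝ := fun x => φ (A x) * ψ (B x) - φ (B x) * ψ (A x) with hδ
  have hδs : ContDiffOn ℝ ∞ δ D := (hφA.mul hψB).sub (hφB.mul hψA)
  have hev : ∀ᶠ x in 𝓝 x₀, x ∈ D ∧ δ x ≠ 0 :=
    (hD.eventually_mem hx₀).and
      ((hδs.continuousOn.continuousAt (hD.mem_nhds hx₀)).eventually_ne hdet)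
  obtain ⟨ε, hε, hball⟩ := Metric.eventually_nhds_iff_ball.1 hev
  have hxb : x₀ ∈ Metric.ball x₀ ε := Metric.mem_ball_self hε
  set O := Metric.ball x₀ ε with hO
  have hOo : IsOpen O := Metric.isOpen_ball
  have hOD : O ⊆ D := fun x hx => (hball x hx).1
  have hδ0 : ∀ x ∈ O, δ x ≠ 0 := fun x hx => (hball x hx).2
  -- A vector of the plane is determined by its values under `φ` and `ψ`, so that a section with
  -- constant values is constant.
  have const : ∀ c d : ℝ × ℝ → ℝ, ContDiffOn ℝ ∞ c O → ContDiffOn ℝ ∞ d O → ∀ k l : ℝ,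
      (∀ x ∈ O, φ (c x • A x + d x • B x) = k) → (∀ x ∈ O, ψ (c x • A x + d x • B x) = l) →
      ∀ x ∈ O, c x • A x + d x • B x = c x₀ • A x₀ + d x₀ • B x₀ := by
    intro c d hc hd k l hk hl
    have hE : ContDiffOn ℝ ∞ (fun x => c x • A x + d x • B x) O :=
      (hc.smul (hA.mono hOD)).add (hd.smul (hB.mono hOD))
    have hz : ∀ x ∈ O, fderiv ℝ (fun x => c x • A x + d x • B x) x = 0 := by
      intro x hx
      refine ContinuousLinearMap.ext fun w => ?_
      have hcx := hc.diffAt hOo hx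
      have hdx := hd.diffAt hOo hx
      have hAx := (hA.mono hOD).diffAt hOo hx
      have hBx := (hB.mono hOD).diffAt hOo hx
      have hExp : dirDeriv w (fun x => c x • A x + d x • B x) x
          = dirDeriv w c x • A x + c x • dirDeriv w A x
            + (dirDeriv w d x • B x + d x • dirDeriv w B x) :=
        dirDeriv_smul_add_smul hcx hdx hAx hBx
      have hmem : dirDeriv w (fun x => c x • A x + d x • B x) x
          ∈ Submodule.span ℝ {A x, B x} := by
        have mA : A x ∈ Submodule.span ℝ {A x, B x} := Submodule.subset_span (by simp)
        have mB : B x ∈ Submodule.span ℝ {A x, B x} := Submodule.subset_span (by simp)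
        rw [hExp]
        exact add_mem (add_mem (Submodule.smul_mem _ _ mA)
          (Submodule.smul_mem _ _ (hdA x (hOD hx) w)))
          (add_mem (Submodule.smul_mem _ _ mB) (Submodule.smul_mem _ _ (hdB x (hOD hx) w)))
      have annih : ∀ (χ : LieVec →L[ℝ] ℝ) (k : ℝ),
          (∀ x ∈ O, χ (c x • A x + d x • B x) = k) →
          χ (dirDeriv w (fun x => c x • A x + d x • B x) x) = 0 := by
        intro χ k hχ
        have h1 : HasFDerivAt (fun x => χ (c x • A x + d x • B x)) _ x :=
          χ.hasFDerivAt.comp x (hE.diffAt hOo hx).hasFDerivAt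
        have h2 := dirDeriv_congr (w := w) (h := fun _ => k) hOo hχ hx
        rw [dirDeriv_const, dirDeriv, h1.fderiv] at h2
        exact h2
      have hφ0 := annih φ k hk
      have hψ0 := annih ψ l hl
      change dirDeriv w (fun x => c x • A x + d x • B x) x = 0
      obtain ⟨s, r, hsr⟩ := Submodule.mem_span_pair.1 hmem
      rw [← hsr] at hφ0 hψ0 ⊢
      simp only [map_add, map_smul, smul_eq_mul] at hφ0 hψ0
      have hd0 := hδ0 x hx
      have hs : s = 0 := by
        have : s * δ x = 0 := by
          simp only [hδ]; linear_combination ψ (B x) * hφ0 - φ (B x) * hψ0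
        exact (mul_eq_zero.1 this).resolve_right hd0
      have hr : r = 0 := by
        have : r * δ x = 0 := by
          simp only [hδ]; linear_combination φ (A x) * hψ0 - ψ (A x) * hφ0
        exact (mul_eq_zero.1 this).resolve_right hd0
      rw [hs, hr, zero_smul, zero_smul, zero_add]
    intro x hx
    exact (convex_ball x₀ ε).is_const_of_fderivWithin_eq_zero (𝕜 := ℝ)
      (hE.differentiableOn (by simp))
      (fun y hy => by rw [fderivWithin_of_isOpen hOo hy, hz y hy]) hx hxb
  have hδi : ContDiffOn ℝ ∞ (fun x => (δ x)⁻¹) O := (hδs.mono hOD).inv hδ0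
  have h1 := const (fun x => (δ x)⁻¹ * ψ (B x)) (fun x => -((δ x)⁻¹ * ψ (A x)))
    (hδi.mul (hψB.mono hOD)) (hδi.mul (hψA.mono hOD)).neg 1 0
    (fun x hx => by
      have := hδ0 x hx
      simp only [map_add, map_smul, smul_eq_mul]
      have e : (δ x)⁻¹ * δ x = 1 := inv_mul_cancel₀ this
      linear_combination e)
    (fun x hx => by simp only [map_add, map_smul, smul_eq_mul]; ring)
  have h2 := const (fun x => -((δ x)⁻¹ * φ (B x))) (fun x => (δ x)⁻¹ * φ (A x))
    (hδi.mul (hφB.mono hOD)).neg (hδi.mul (hφA.mono hOD)) 0 1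
    (fun x hx => by simp only [map_add, map_smul, smul_eq_mul]; ring)
    (fun x hx => by
      have := hδ0 x hx
      simp only [map_add, map_smul, smul_eq_mul]
      have e : (δ x)⁻¹ * δ x = 1 := inv_mul_cancel₀ this
      linear_combination e)
  -- The dual basis of `φ, ψ` in the plane at `x` spans the plane.
  have hspan : ∀ x ∈ O, Submodule.span ℝ {A x, B x} = Submodule.span ℝ
      {((δ x)⁻¹ * ψ (B x)) • A x + (-((δ x)⁻¹ * ψ (A x))) • B x,
        (-((δ x)⁻¹ * φ (B x))) • A x + ((δ x)⁻¹ * φ (A x)) • B x} := by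
    intro x hx
    have e : (δ x)⁻¹ * (φ (A x) * ψ (B x) - φ (B x) * ψ (A x)) = 1 :=
      inv_mul_cancel₀ (hδ0 x hx)
    apply le_antisymm
    · rw [Submodule.span_le]
      rintro y (rfl | rfl)
      · refine Submodule.mem_span_pair.2 ⟨φ (A x), ψ (A x), ?_⟩
        match_scalars
        · linear_combination e
        · ring
      · refine Submodule.mem_span_pair.2 ⟨φ (B x), ψ (B x), ?_⟩
        match_scalars
        · ring
        · linear_combination e
    · rw [Submodule.span_le]
      rintro y (rfl | rfl)
      · exact Submodule.mem_span_pair.2 ⟨_, _, rfl⟩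
      · exact Submodule.mem_span_pair.2 ⟨_, _, rfl⟩
  filter_upwards [hOo.mem_nhds hxb] with x hx
  rw [hspan x hx, hspan x₀ hxb, h1 x hx, h2 x hx]

/-! ### Channel linear Weingarten surfaces in coordinates -/

/-- The linear combination `a G + b H` of two vector-valued maps. -/
def combine (a b : ℝ × ℝ → ℝ) (G H : ℝ × ℝ → LieVec) (x : ℝ × ℝ) : LieVec :=
  a x • G x + b x • H x

theorem ContDiffOn.combine {D : Set (ℝ × ℝ)} {a b : ℝ × ℝ → ℝ} {G H : ℝ × ℝ → LieVec}
    (ha : ContDiffOn ℝ ∞ a D) (hb : ContDiffOn ℝ ∞ b D) (hG : ContDiffOn ℝ ∞ G D)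
    (hH : ContDiffOn ℝ ∞ H D) : ContDiffOn ℝ ∞ (combine a b G H) D :=
  (ha.smul hG).add (hb.smul hH)

theorem dirDeriv_combine {D : Set (ℝ × ℝ)} {a b : ℝ × ℝ → ℝ} {G H : ℝ × ℝ → LieVec}
    (hD : IsOpen D) (ha : ContDiffOn ℝ ∞ a D) (hb : ContDiffOn ℝ ∞ b D)
    (hG : ContDiffOn ℝ ∞ G D) (hH : ContDiffOn ℝ ∞ H D) {x : ℝ × ℝ} (hx : x ∈ D) (w : ℝ × ℝ) :
    dirDeriv w (combine a b G H) x
      = combine (dirDeriv w a) (dirDeriv w b) G H x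
        + combine a b (dirDeriv w G) (dirDeriv w H) x := by
  unfold combine
  rw [dirDeriv_smul_add_smul (ha.diffAt hD hx) (hb.diffAt hD hx) (hG.diffAt hD hx)
    (hH.diffAt hD hx)]
  abel

/-- Coordinates `(u, v)` of a surface `(F, T)` in which its curvature spheres are
`a₁ F + b₁ T`, constant along the `v`-curves, and `a₂ F + b₂ T`, where the coefficients depend on
`u` only. For the first sphere this expresses that the surface is a channel surface, for the
second one that it is linear Weingarten and not tubular. -/
structure ChannelChart (p q : LieVec) (D : Set (ℝ × ℝ)) (F T : ℝ × ℝ → LieVec)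
    (a₁ b₁ a₂ b₂ : ℝ × ℝ → ℝ) : Prop where
  isOpen : IsOpen D
  smooth_F : ContDiffOn ℝ ∞ F D
  smooth_T : ContDiffOn ℝ ∞ T D
  smooth_a₁ : ContDiffOn ℝ ∞ a₁ D
  smooth_b₁ : ContDiffOn ℝ ∞ b₁ D
  smooth_a₂ : ContDiffOn ℝ ∞ a₂ D
  smooth_b₂ : ContDiffOn ℝ ∞ b₂ D
  deriv_a₁ : ∀ x ∈ D, ∂₂ a₁ x = 0
  deriv_b₁ : ∀ x ∈ D, ∂₂ b₁ x = 0
  deriv_a₂ : ∀ x ∈ D, ∂₂ a₂ x = 0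
  deriv_b₂ : ∀ x ∈ D, ∂₂ b₂ x = 0
  mem_F : ∀ x ∈ D, F x ∈ spaceForm p q
  mem_T : ∀ x ∈ D, T x ∈ planeSpace p q
  incident : ∀ x ∈ D, lieForm (F x) (T x) = 0
  contact : ∀ x ∈ D, ∀ w, lieForm (dirDeriv w F x) (T x) = 0
  immersion : ∀ x ∈ D, ∀ w, dirDeriv w F x = 0 → dirDeriv w T x = 0 → w = 0
  det_ne : ∀ x ∈ D, a₁ x * b₂ x - a₂ x * b₁ x ≠ 0
  sphere₁ : ∀ x ∈ D, combine a₁ b₁ (∂₂ F) (∂₂ T) x = 0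
  sphere₂ : ∀ x ∈ D, ∃ m : ℝ,
    combine a₂ b₂ (∂₁ F) (∂₁ T) x = m • combine a₂ b₂ (∂₂ F) (∂₂ T) x

namespace ChannelChart

variable {p q : LieVec} {D : Set (ℝ × ℝ)} {F T : ℝ × ℝ → LieVec} {a₁ b₁ a₂ b₂ : ℝ × ℝ → ℝ}
  {x : ℝ × ℝ}

/-- The first curvature sphere. -/
local notation "σ₁" => combine a₁ b₁ F T

/-- The second curvature sphere. -/
local notation "σ₂" => combine a₂ b₂ F T

/-- The tangent direction of the circular curvature lines. -/
local notation "ω" => combine a₂ b₂ (dirDeriv ((0 : ℝ), (1 : ℝ)) F) (dirDeriv ((0 : ℝ), (1 : ℝ)) T)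

theorem smooth_σ₁ (h : ChannelChart p q D F T a₁ b₁ a₂ b₂) : ContDiffOn ℝ ∞ σ₁ D :=
  h.smooth_a₁.combine h.smooth_b₁ h.smooth_F h.smooth_T

theorem smooth_σ₂ (h : ChannelChart p q D F T a₁ b₁ a₂ b₂) : ContDiffOn ℝ ∞ σ₂ D :=
  h.smooth_a₂.combine h.smooth_b₂ h.smooth_F h.smooth_T

theorem smooth_ω (h : ChannelChart p q D F T a₁ b₁ a₂ b₂) : ContDiffOn ℝ ∞ ω D :=
  h.smooth_a₂.combine h.smooth_b₂ (h.smooth_F.dirDeriv h.isOpen _)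
    (h.smooth_T.dirDeriv h.isOpen _)

theorem perp_dirDeriv_F (h : ChannelChart p q D F T a₁ b₁ a₂ b₂) (hx : x ∈ D) (w : ℝ × ℝ) :
    lieForm (dirDeriv w F x) p = 0 ∧ lieForm (dirDeriv w F x) q = 0 ∧
      lieForm (dirDeriv w F x) (F x) = 0 ∧ lieForm (dirDeriv w F x) (T x) = 0 := by
  refine ⟨lieForm_dirDeriv_eq_zero h.isOpen h.smooth_F (fun y hy => (h.mem_F y hy).2.1) hx w,
    lieForm_dirDeriv_eq_zero h.isOpen h.smooth_F (fun y hy => (h.mem_F y hy).2.2) hx w, ?_,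
    h.contact x hx w⟩
  have := lieForm_dirDeriv_add_eq_zero h.isOpen h.smooth_F h.smooth_F
    (fun y hy => (h.mem_F y hy).1) hx w
  rw [lieForm_comm (F x)] at this
  linarith

theorem perp_dirDeriv_T (h : ChannelChart p q D F T a₁ b₁ a₂ b₂) (hx : x ∈ D) (w : ℝ × ℝ) :
    lieForm (dirDeriv w T x) p = 0 ∧ lieForm (dirDeriv w T x) q = 0 ∧
      lieForm (dirDeriv w T x) (F x) = 0 ∧ lieForm (dirDeriv w T x) (T x) = 0 := by
  refine ⟨lieForm_dirDeriv_eq_zero h.isOpen h.smooth_T (fun y hy => (h.mem_T y hy).2.1) hx w,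
    lieForm_dirDeriv_eq_zero h.isOpen h.smooth_T (fun y hy => (h.mem_T y hy).2.2) hx w, ?_, ?_⟩
  · have := lieForm_dirDeriv_add_eq_zero h.isOpen h.smooth_F h.smooth_T h.incident hx w
    rw [h.contact x hx w, lieForm_comm (F x)] at this
    linarith
  · have := lieForm_dirDeriv_add_eq_zero h.isOpen h.smooth_T h.smooth_T
      (fun y hy => (h.mem_T y hy).1) hx w
    rw [lieForm_comm (T x)] at this
    linarith

theorem perp_combine (h : ChannelChart p q D F T a₁ b₁ a₂ b₂) (hx : x ∈ D) (w : ℝ × ℝ)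
    (a b : ℝ × ℝ → ℝ) :
    lieForm (combine a b (dirDeriv w F) (dirDeriv w T) x) p = 0 ∧
      lieForm (combine a b (dirDeriv w F) (dirDeriv w T) x) q = 0 ∧
      lieForm (combine a b (dirDeriv w F) (dirDeriv w T) x) (F x) = 0 ∧
      lieForm (combine a b (dirDeriv w F) (dirDeriv w T) x) (T x) = 0 := by
  obtain ⟨h1, h2, h3, h4⟩ := h.perp_dirDeriv_F hx w
  obtain ⟨k1, k2, k3, k4⟩ := h.perp_dirDeriv_T hx w
  simp [combine, h1, h2, h3, h4, k1, k2, k3, k4]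

theorem smul_dirDeriv_F (h : ChannelChart p q D F T a₁ b₁ a₂ b₂) (hx : x ∈ D) :
    (a₁ x * b₂ x - a₂ x * b₁ x) • ∂₂ F x = -b₁ x • ω x := by
  have := h.sphere₁ x hx
  unfold combine at this ⊢
  linear_combination (norm := module) b₂ x • this

theorem smul_dirDeriv_T (h : ChannelChart p q D F T a₁ b₁ a₂ b₂) (hx : x ∈ D) :
    (a₁ x * b₂ x - a₂ x * b₁ x) • ∂₂ T x = a₁ x • ω x := by
  have := h.sphere₁ x hx
  unfold combine at this ⊢
  linear_combination (norm := module) -a₂ x • this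

theorem ω_ne_zero (h : ChannelChart p q D F T a₁ b₁ a₂ b₂) (hx : x ∈ D) : ω x ≠ 0 := by
  intro h0
  have hF := h.smul_dirDeriv_F hx
  have hT := h.smul_dirDeriv_T hx
  rw [h0, smul_zero] at hF hT
  have := h.immersion x hx _ ((smul_eq_zero.1 hF).resolve_left (h.det_ne x hx))
    ((smul_eq_zero.1 hT).resolve_left (h.det_ne x hx))
  simp at this

theorem ω_pos (h : ChannelChart p q D F T a₁ b₁ a₂ b₂) (hp : lieForm p p = -1)
    (hpq : lieForm p q = 0) (hx : x ∈ D) : 0 < lieForm (ω x) (ω x) := by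
  obtain ⟨h1, h2, h3, -⟩ := h.perp_combine hx (0, 1) a₂ b₂
  exact lieForm_self_pos_of_perp hp hpq (h.mem_F x hx) h1 h2 h3 (h.ω_ne_zero hx)

theorem dirDeriv_σ₁ (h : ChannelChart p q D F T a₁ b₁ a₂ b₂) (hx : x ∈ D) : ∂₂ σ₁ x = 0 := by
  rw [dirDeriv_combine h.isOpen h.smooth_a₁ h.smooth_b₁ h.smooth_F h.smooth_T hx, h.sphere₁ x hx]
  simp [combine, h.deriv_a₁ x hx, h.deriv_b₁ x hx]

theorem dirDeriv_σ₂ (h : ChannelChart p q D F T a₁ b₁ a₂ b₂) (hx : x ∈ D) : ∂₂ σ₂ x = ω x := by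
  rw [dirDeriv_combine h.isOpen h.smooth_a₂ h.smooth_b₂ h.smooth_F h.smooth_T hx]
  simp [combine, h.deriv_a₂ x hx, h.deriv_b₂ x hx]

theorem dirDeriv_dirDeriv_σ₁ (h : ChannelChart p q D F T a₁ b₁ a₂ b₂) (hx : x ∈ D) :
    ∂₂ (∂₁ σ₁) x = 0 := by
  rw [dirDeriv_comm h.smooth_σ₁ h.isOpen hx,
    dirDeriv_congr (h := fun _ => 0) h.isOpen (fun y hy => h.dirDeriv_σ₁ hy) hx, dirDeriv_const]

theorem ω_perp_σ₁ (h : ChannelChart p q D F T a₁ b₁ a₂ b₂) (hx : x ∈ D) :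
    lieForm (ω x) (σ₁ x) = 0 := by
  obtain ⟨-, -, h3, h4⟩ := h.perp_combine hx (0, 1) a₂ b₂
  rw [combine.eq_def a₁, map_add, map_smul, map_smul, h3, h4]
  simp

theorem ω_perp_σ₂ (h : ChannelChart p q D F T a₁ b₁ a₂ b₂) (hx : x ∈ D) :
    lieForm (ω x) (σ₂ x) = 0 := by
  obtain ⟨-, -, h3, h4⟩ := h.perp_combine hx (0, 1) a₂ b₂
  rw [combine.eq_def _ _ F T, map_add, map_smul, map_smul, h3, h4]
  simp

theorem lieForm_dirDeriv_ω_σ₂ (h : ChannelChart p q D F T a₁ b₁ a₂ b₂) (hx : x ∈ D) :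
    lieForm (∂₂ ω x) (σ₂ x) = -lieForm (ω x) (ω x) := by
  have := lieForm_dirDeriv_add_eq_zero h.isOpen h.smooth_ω h.smooth_σ₂
    (fun y hy => h.ω_perp_σ₂ hy) hx (0, 1)
  rw [h.dirDeriv_σ₂ hx] at this
  linarith

/-- The map `ω` changes in the plane `⟨ω, ∂₂ ω⟩` along the other curvature lines. This is where
both the channel and the linear Weingarten property enter: the coefficients of both curvature
spheres depend on the first coordinate only. -/
theorem dirDeriv_ω (h : ChannelChart p q D F T a₁ b₁ a₂ b₂) (hp : lieForm p p = -1)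
    (hpq : lieForm p q = 0) :
    ∃ l m : ℝ × ℝ → ℝ, ContDiffOn ℝ ∞ l D ∧ ContDiffOn ℝ ∞ m D ∧
      ∀ x ∈ D, ∂₁ ω x = l x • ω x + m x • ∂₂ ω x := by
  have hF₂ := h.smooth_F.dirDeriv h.isOpen (0, 1)
  have hT₂ := h.smooth_T.dirDeriv h.isOpen (0, 1)
  have hF₁ := h.smooth_F.dirDeriv h.isOpen (1, 0)
  have hT₁ := h.smooth_T.dirDeriv h.isOpen (1, 0)
  have hP := h.smooth_a₂.combine h.smooth_b₂ hF₁ hT₁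
  set P := combine a₂ b₂ (∂₁ F) (∂₁ T) with hPdef
  have hpos : ∀ x ∈ D, lieForm (ω x) (ω x) ≠ 0 := fun x hx => (h.ω_pos hp hpq hx).ne'
  set m : ℝ × ℝ → ℝ := fun x => lieForm (P x) (ω x) / lieForm (ω x) (ω x) with hm
  have hms : ContDiffOn ℝ ∞ m D := (hP.lieForm h.smooth_ω).div (h.smooth_ω.lieForm h.smooth_ω) hpos
  have hPm : ∀ x ∈ D, P x = m x • ω x := by
    intro x hx
    obtain ⟨k, hk⟩ := h.sphere₂ x hx
    have : m x = k := by
      simp only [hm]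
      rw [show P x = _ from hk, map_smul, LinearMap.smul_apply, smul_eq_mul,
        mul_div_cancel_right₀ _ (hpos x hx)]
    rw [this]
    exact hk
  have hdet : ContDiffOn ℝ ∞ (fun x => a₁ x * b₂ x - a₂ x * b₁ x) D :=
    (h.smooth_a₁.mul h.smooth_b₂).sub (h.smooth_a₂.mul h.smooth_b₁)
  set k : ℝ × ℝ → ℝ := fun x => (-(∂₁ a₂ x * b₁ x) + ∂₁ b₂ x * a₁ x)
    / (a₁ x * b₂ x - a₂ x * b₁ x) with hk
  have hks : ContDiffOn ℝ ∞ k D :=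
    (((h.smooth_a₂.dirDeriv h.isOpen _).mul h.smooth_b₁).neg.add
      ((h.smooth_b₂.dirDeriv h.isOpen _).mul h.smooth_a₁)).div hdet h.det_ne
  refine ⟨fun x => k x + ∂₂ m x, m, hks.add (hms.dirDeriv h.isOpen _), hms, fun x hx => ?_⟩
  have e1 := dirDeriv_combine h.isOpen h.smooth_a₂ h.smooth_b₂ hF₂ hT₂ hx (1, 0)
  have e2 : ∂₂ P x = combine a₂ b₂ (∂₁ (∂₂ F)) (∂₁ (∂₂ T)) x := by
    rw [hPdef, dirDeriv_combine h.isOpen h.smooth_a₂ h.smooth_b₂ hF₁ hT₁ hx]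
    simp only [combine, h.deriv_a₂ x hx, h.deriv_b₂ x hx, zero_smul, zero_add]
    rw [dirDeriv_comm h.smooth_F h.isOpen hx, dirDeriv_comm h.smooth_T h.isOpen hx]
  have e3 : ∂₂ P x = ∂₂ m x • ω x + m x • ∂₂ ω x := by
    rw [dirDeriv_congr h.isOpen hPm hx,
      dirDeriv_smul (hms.diffAt h.isOpen hx) (h.smooth_ω.diffAt h.isOpen hx)]
  have e4 : combine (∂₁ a₂) (∂₁ b₂) (∂₂ F) (∂₂ T) x = k x • ω x := by
    have hd := h.det_ne x hx
    apply smul_right_injective _ hd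
    have e5 : (a₁ x * b₂ x - a₂ x * b₁ x) * k x = -(∂₁ a₂ x * b₁ x) + ∂₁ b₂ x * a₁ x :=
      mul_div_cancel₀ _ hd
    simp only [smul_smul, e5]
    rw [combine.eq_def (∂₁ a₂)]
    linear_combination (norm := module)
      ∂₁ a₂ x • h.smul_dirDeriv_F hx + ∂₁ b₂ x • h.smul_dirDeriv_T hx
  rw [e1, e4, ← e2, e3]
  module

theorem dirDeriv_ω_perp_σ₁ (h : ChannelChart p q D F T a₁ b₁ a₂ b₂) (hx : x ∈ D) :
    lieForm (∂₂ ω x) (σ₁ x) = 0 := by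
  have := lieForm_dirDeriv_add_eq_zero h.isOpen h.smooth_ω h.smooth_σ₁
    (fun y hy => h.ω_perp_σ₁ hy) hx (0, 1)
  simpa [h.dirDeriv_σ₁ hx] using this

theorem ω_perp_dirDeriv_σ₁ (h : ChannelChart p q D F T a₁ b₁ a₂ b₂) (hp : lieForm p p = -1)
    (hpq : lieForm p q = 0) (hx : x ∈ D) : lieForm (ω x) (∂₁ σ₁ x) = 0 := by
  obtain ⟨l, m, -, -, hlm⟩ := h.dirDeriv_ω hp hpq
  have := lieForm_dirDeriv_add_eq_zero h.isOpen h.smooth_ω h.smooth_σ₁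
    (fun y hy => h.ω_perp_σ₁ hy) hx (1, 0)
  rw [hlm x hx] at this
  simpa [h.ω_perp_σ₁ hx, h.dirDeriv_ω_perp_σ₁ hx] using this

theorem dirDeriv_ω_perp_dirDeriv_σ₁ (h : ChannelChart p q D F T a₁ b₁ a₂ b₂)
    (hp : lieForm p p = -1) (hpq : lieForm p q = 0) (hx : x ∈ D) :
    lieForm (∂₂ ω x) (∂₁ σ₁ x) = 0 := by
  have := lieForm_dirDeriv_add_eq_zero h.isOpen h.smooth_ω (h.smooth_σ₁.dirDeriv h.isOpen (1, 0))
    (fun y hy => h.ω_perp_dirDeriv_σ₁ hp hpq hy) hx (0, 1)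
  simpa [h.dirDeriv_dirDeriv_σ₁ hx] using this

/-- The plane `⟨ω, ∂₂ ω⟩` is the orthogonal complement of `p`, `q`, the first curvature sphere and
its derivative. -/
theorem mem_span_of_perp (h : ChannelChart p q D F T a₁ b₁ a₂ b₂) (hp : lieForm p p = -1)
    (hpq : lieForm p q = 0) (hx : x ∈ D) {y : LieVec} (hyp : lieForm y p = 0)
    (hyq : lieForm y q = 0) (hy₁ : lieForm y (σ₁ x) = 0) (hy₂ : lieForm y (∂₁ σ₁ x) = 0) :
    y ∈ Submodule.span ℝ {ω x, ∂₂ ω x} := by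
  have hω := h.perp_combine hx (0, 1) a₂ b₂
  have hZ := h.perp_combine hx (1, 0) a₁ b₁
  have hpos := h.ω_pos hp hpq hx
  have hσ := h.lieForm_dirDeriv_ω_σ₂ hx
  have hωZ := h.ω_perp_dirDeriv_σ₁ hp hpq hx
  have hdω₁ := h.dirDeriv_ω_perp_σ₁ hx
  have hdω₂ := h.dirDeriv_ω_perp_dirDeriv_σ₁ hp hpq hx
  have hω₁ := h.ω_perp_σ₁ hx
  have hω₂ := h.ω_perp_σ₂ hx
  have hdωp : lieForm (∂₂ ω x) p = 0 := lieForm_dirDeriv_eq_zero h.isOpen h.smooth_ω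
    (fun y hy => (h.perp_combine hy (0, 1) a₂ b₂).1) hx _
  have hdωq : lieForm (∂₂ ω x) q = 0 := lieForm_dirDeriv_eq_zero h.isOpen h.smooth_ω
    (fun y hy => (h.perp_combine hy (0, 1) a₂ b₂).2.1) hx _
  -- The derivative of the first curvature sphere has a component `Z` normal to `F` and `T`.
  have hZ0 : combine a₁ b₁ (∂₁ F) (∂₁ T) x ≠ 0 := by
    intro hz
    obtain ⟨m, hm⟩ := h.sphere₂ x hx
    have h1 := h.sphere₁ x hx
    have hd := h.det_ne x hx
    have hF : dirDeriv (1, -m) F x = 0 := by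
      have h0 : (a₁ x * b₂ x - a₂ x * b₁ x) • dirDeriv (1, -m) F x = 0 := by
        rw [dirDeriv_eq]
        unfold combine at hz hm h1
        linear_combination (norm := module) b₂ x • hz - b₁ x • hm - (m * b₂ x) • h1
      exact (smul_eq_zero.1 h0).resolve_left hd
    have hT : dirDeriv (1, -m) T x = 0 := by
      have h0 : (a₁ x * b₂ x - a₂ x * b₁ x) • dirDeriv (1, -m) T x = 0 := by
        rw [dirDeriv_eq]
        unfold combine at hz hm h1
        linear_combination (norm := module) -a₂ x • hz + a₁ x • hm + (m * a₂ x) • h1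
      exact (smul_eq_zero.1 h0).resolve_left hd
    have := h.immersion x hx _ hF hT
    simp at this
  have hσ₁' := dirDeriv_combine h.isOpen h.smooth_a₁ h.smooth_b₁ h.smooth_F h.smooth_T hx (1, 0)
  set Z := combine a₁ b₁ (∂₁ F) (∂₁ T) x with hZdef
  set b : ℝ := -(lieForm y (σ₂ x) / lieForm (ω x) (ω x)) with hb
  set a : ℝ := (lieForm y (ω x) - b * lieForm (∂₂ ω x) (ω x)) / lieForm (ω x) (ω x) with ha
  have hb' : b * lieForm (ω x) (ω x) = -lieForm y (σ₂ x) := by rw [hb]; field_simp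
  have ha' : a * lieForm (ω x) (ω x) = lieForm y (ω x) - b * lieForm (∂₂ ω x) (ω x) := by
    rw [ha]; field_simp
  set z := y - a • ω x - b • ∂₂ ω x with hz
  have zform : ∀ n, lieForm z n
      = lieForm y n - a * lieForm (ω x) n - b * lieForm (∂₂ ω x) n := by
    intro n; simp [hz]
  have hz₁ : lieForm z (σ₁ x) = 0 := by rw [zform, hy₁, hω₁, hdω₁]; ring
  have hz₂ : lieForm z (σ₂ x) = 0 := by rw [zform, hω₂, hσ]; linear_combination hb'
  have hd := h.det_ne x hx
  have hz₁' : a₁ x * lieForm z (F x) + b₁ x * lieForm z (T x) = 0 := by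
    simpa [combine] using hz₁
  have hz₂' : a₂ x * lieForm z (F x) + b₂ x * lieForm z (T x) = 0 := by
    simpa [combine] using hz₂
  have hzF : lieForm z (F x) = 0 := by
    refine (mul_eq_zero.1 (?_ : (a₁ x * b₂ x - a₂ x * b₁ x) * _ = 0)).resolve_left hd
    linear_combination b₂ x * hz₁' - b₁ x * hz₂'
  have hzT : lieForm z (T x) = 0 := by
    refine (mul_eq_zero.1 (?_ : (a₁ x * b₂ x - a₂ x * b₁ x) * _ = 0)).resolve_left hd
    linear_combination a₁ x * hz₂' - a₂ x * hz₁'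
  have comp : ∀ n, lieForm n (F x) = 0 → lieForm n (T x) = 0 → lieForm n (∂₁ σ₁ x) = 0 →
      lieForm n Z = 0 := by
    intro n hF hT hn
    rw [hσ₁', map_add, combine.eq_def (∂₁ a₁), map_add, map_smul, map_smul, hF, hT] at hn
    simpa using hn
  have hz0 : z = 0 := by
    refine eq_zero_of_perp_six hp hpq (h.mem_F x hx) (h.mem_T x hx) (h.incident x hx) hω hZ
      ⟨?_, ?_, hzF, hzT⟩ (h.ω_ne_zero hx) hZ0 (comp _ hω.2.2.1 hω.2.2.2 hωZ) ?_
      (comp _ hzF hzT ?_)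
    · rw [zform, hyp, hω.1, hdωp]; ring
    · rw [zform, hyq, hω.2.1, hdωq]; ring
    · rw [zform]; linear_combination -ha'
    · rw [zform, hy₂, hωZ, hdω₂]; ring
  refine Submodule.mem_span_pair.2 ⟨a, b, ?_⟩
  rw [← sub_eq_zero, ← neg_eq_zero, ← hz0, hz]
  abel

theorem perp_of_mem_span (h : ChannelChart p q D F T a₁ b₁ a₂ b₂) (hx : x ∈ D) {y : LieVec}
    (hy : y ∈ Submodule.span ℝ {ω x, ∂₂ ω x}) :
    lieForm y p = 0 ∧ lieForm y q = 0 ∧ lieForm y (σ₁ x) = 0 := by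
  have hdωp : lieForm (∂₂ ω x) p = 0 := lieForm_dirDeriv_eq_zero h.isOpen h.smooth_ω
    (fun y hy => (h.perp_combine hy (0, 1) a₂ b₂).1) hx _
  have hdωq : lieForm (∂₂ ω x) q = 0 := lieForm_dirDeriv_eq_zero h.isOpen h.smooth_ω
    (fun y hy => (h.perp_combine hy (0, 1) a₂ b₂).2.1) hx _
  have hω := h.perp_combine hx (0, 1) a₂ b₂
  obtain ⟨s, r, rfl⟩ := Submodule.mem_span_pair.1 hy
  simp [hdωp, hdωq, hω.1, hω.2.1, h.ω_perp_σ₁ hx, h.dirDeriv_ω_perp_σ₁ hx]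

theorem finrank_span (h : ChannelChart p q D F T a₁ b₁ a₂ b₂) (hp : lieForm p p = -1)
    (hpq : lieForm p q = 0) (hx : x ∈ D) :
    Module.finrank ℝ (Submodule.span ℝ {ω x, ∂₂ ω x}) = 2 := by
  have hli : LinearIndependent ℝ ![ω x, ∂₂ ω x] := by
    rw [LinearIndependent.pair_iff]
    intro s r hsr
    have hpos := h.ω_pos hp hpq hx
    have h1 := congrArg (fun y => lieForm y (σ₂ x)) hsr
    simp [h.ω_perp_σ₂ hx, h.lieForm_dirDeriv_ω_σ₂ hx, hpos.ne'] at h1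
    rw [h1, zero_smul, add_zero] at hsr
    exact ⟨(smul_eq_zero.1 hsr).resolve_right (h.ω_ne_zero hx), h1⟩
  have hr : range ![ω x, ∂₂ ω x] = {ω x, ∂₂ ω x} := by
    rw [Matrix.range_cons, Matrix.range_cons, Matrix.range_empty, union_empty, singleton_union]
  rw [← hr, finrank_span_eq_card hli, Fintype.card_fin]

/-- The planes `⟨ω, ∂₂ ω⟩`, which contain the circular curvature lines, are locally constant. -/
theorem eventually_span_eq (h : ChannelChart p q D F T a₁ b₁ a₂ b₂) (hp : lieForm p p = -1)
    (hpq : lieForm p q = 0) (hx : x ∈ D) :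
    ∀ᶠ y in 𝓝 x, Submodule.span ℝ {ω y, ∂₂ ω y} = Submodule.span ℝ {ω x, ∂₂ ω x} := by
  obtain ⟨l, m, hl, hm, hlm⟩ := h.dirDeriv_ω hp hpq
  have hω₂ := h.smooth_ω.dirDeriv h.isOpen (0, 1)
  have m1 : ∀ y, ω y ∈ Submodule.span ℝ {ω y, ∂₂ ω y} := fun y => Submodule.subset_span (by simp)
  have m2 : ∀ y, ∂₂ ω y ∈ Submodule.span ℝ {ω y, ∂₂ ω y} := fun y =>
    Submodule.subset_span (by simp)
  have hv : ∀ y ∈ D, ∂₂ (∂₂ ω) y ∈ Submodule.span ℝ {ω y, ∂₂ ω y} := by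
    intro y hy
    refine h.mem_span_of_perp hp hpq hy
      (lieForm_dirDeriv_eq_zero h.isOpen hω₂ (fun z hz => (h.perp_of_mem_span hz (m2 z)).1) hy _)
      (lieForm_dirDeriv_eq_zero h.isOpen hω₂ (fun z hz => (h.perp_of_mem_span hz (m2 z)).2.1)
        hy _) ?_ ?_
    · have := lieForm_dirDeriv_add_eq_zero h.isOpen hω₂ h.smooth_σ₁
        (fun z hz => h.dirDeriv_ω_perp_σ₁ hz) hy (0, 1)
      simpa [h.dirDeriv_σ₁ hy] using this
    · have := lieForm_dirDeriv_add_eq_zero h.isOpen hω₂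
        (h.smooth_σ₁.dirDeriv h.isOpen (1, 0))
        (fun z hz => h.dirDeriv_ω_perp_dirDeriv_σ₁ hp hpq hz) hy (0, 1)
      simpa [h.dirDeriv_dirDeriv_σ₁ hy] using this
  have hpos := h.ω_pos hp hpq hx
  refine eventually_span_pair_eq h.isOpen h.smooth_ω hω₂ ?_ ?_ (lieFormL (ω x)) (lieFormL (σ₂ x))
    hx ?_
  · intro y hy w
    rw [dirDeriv_eq w ω y, hlm y hy]
    exact add_mem (Submodule.smul_mem _ _ (add_mem (Submodule.smul_mem _ _ (m1 y))
      (Submodule.smul_mem _ _ (m2 y)))) (Submodule.smul_mem _ _ (m2 y))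
  · intro y hy w
    rw [dirDeriv_eq w (∂₂ ω) y, dirDeriv_comm h.smooth_ω h.isOpen hy,
      dirDeriv_congr h.isOpen hlm hy, dirDeriv_smul_add_smul (hl.diffAt h.isOpen hy)
        (hm.diffAt h.isOpen hy) (h.smooth_ω.diffAt h.isOpen hy) (hω₂.diffAt h.isOpen hy)]
    exact add_mem (Submodule.smul_mem _ _ (add_mem (add_mem (Submodule.smul_mem _ _ (m1 y))
      (Submodule.smul_mem _ _ (m2 y))) (add_mem (Submodule.smul_mem _ _ (m2 y))
      (Submodule.smul_mem _ _ (hv y hy))))) (Submodule.smul_mem _ _ (hv y hy))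
  · simp only [lieFormL_apply]
    rw [lieForm_comm (σ₂ x) (∂₂ ω x), h.lieForm_dirDeriv_ω_σ₂ hx, lieForm_comm (σ₂ x) (ω x),
      h.ω_perp_σ₂ hx]
    simp [hpos.ne']

end ChannelChart

/-! ### One-parameter groups of rotations -/

/-- The infinitesimal rotation `x ↦ (e, x) v - (v, x) e` in the plane `⟨e, v⟩`. -/
noncomputable def rotGen (e v : LieVec) : LieVec →L[ℝ] LieVec :=
  (lieFormL e).smulRight v - (lieFormL v).smulRight e

theorem rotGen_apply (e v x : LieVec) : rotGen e v x = lieForm e x • v - lieForm v x • e := rfl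

theorem lieForm_rotGen (e v x y : LieVec) :
    lieForm (rotGen e v x) y + lieForm x (rotGen e v y) = 0 := by
  simp only [rotGen_apply, map_sub, map_smul, LinearMap.sub_apply, LinearMap.smul_apply,
    smul_eq_mul, lieForm_comm x v, lieForm_comm x e]
  ring

/-- The one-parameter group of rotations in the plane `⟨e, v⟩`. -/
noncomputable def rot (e v : LieVec) (θ : ℝ) : LieVec →L[ℝ] LieVec :=
  NormedSpace.exp (θ • rotGen e v)

theorem hasDerivAt_rot (e v : LieVec) (θ : ℝ) :
    HasDerivAt (rot e v) ((rot e v θ).comp (rotGen e v)) θ :=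
  hasDerivAt_exp_smul_const (𝕂 := ℝ) (rotGen e v) θ

theorem hasDerivAt_rot' (e v : LieVec) (θ : ℝ) :
    HasDerivAt (rot e v) ((rotGen e v).comp (rot e v θ)) θ :=
  hasDerivAt_exp_smul_const' (𝕂 := ℝ) (rotGen e v) θ

theorem rot_zero (e v : LieVec) : rot e v 0 = ContinuousLinearMap.id ℝ LieVec := by
  rw [rot, zero_smul, NormedSpace.exp_zero]; rfl

theorem rot_add (e v : LieVec) (θ η : ℝ) : rot e v (θ + η) = (rot e v θ).comp (rot e v η) := by
  let _ : NormedAlgebra ℚ (LieVec →L[ℝ] LieVec) := NormedAlgebra.restrictScalars ℚ ℝ _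
  rw [rot, add_smul]
  exact NormedSpace.exp_add_of_commute
    (((Commute.refl (rotGen e v)).smul_left θ).smul_right η)

theorem rot_apply_eq_self {e v x : LieVec} (hx : rotGen e v x = 0) (θ : ℝ) :
    rot e v θ x = x := by
  have hd : ∀ θ, HasDerivAt (fun θ => rot e v θ x) 0 θ := by
    intro θ
    have := (hasDerivAt_rot e v θ).clm_apply (hasDerivAt_const θ x)
    simpa [hx] using this
  have := is_const_of_deriv_eq_zero (fun θ => (hd θ).differentiableAt) (fun θ => (hd θ).deriv) θ 0
  simpa [rot_zero] using this

theorem lieForm_rot (e v : LieVec) (θ : ℝ) (x y : LieVec) :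
    lieForm (rot e v θ x) (rot e v θ y) = lieForm x y := by
  have hd : ∀ θ, HasDerivAt (fun θ => lieFormL (rot e v θ x) (rot e v θ y)) 0 θ := by
    intro θ
    have hx := (hasDerivAt_rot' e v θ).clm_apply (hasDerivAt_const θ x)
    have hy := (hasDerivAt_rot' e v θ).clm_apply (hasDerivAt_const θ y)
    have h := (lieFormL.hasFDerivAt.comp_hasDerivAt θ hx).clm_apply hy
    refine h.congr_deriv ?_
    simpa [lieFormL_apply] using lieForm_rotGen e v (rot e v θ x) (rot e v θ y)
  have := is_const_of_deriv_eq_zero (fun θ => (hd θ).differentiableAt) (fun θ => (hd θ).deriv) θ 0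
  simpa [rot_zero, lieFormL_apply] using this

theorem linearIndependent_of_orthogonal {e v : LieVec} (he : lieForm e e = 1)
    (hev : lieForm e v = 0)
    (hv : v ≠ 0) : LinearIndependent ℝ ![e, v] := by
  rw [LinearIndependent.pair_iff]
  intro s r hsr
  have h1 := congrArg (fun y => lieForm e y) hsr
  simp [he, hev] at h1
  rw [h1, zero_smul, zero_add] at hsr
  exact ⟨h1, (smul_eq_zero.1 hsr).resolve_right hv⟩

theorem isRotationSubgroup_rot {p q e v : LieVec} (he : lieForm e e = 1) (hev : lieForm e v = 0)
    (hv : v ≠ 0) (hep : lieForm e p = 0) (heq : lieForm e q = 0) (hvp : lieForm v p = 0)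
    (hvq : lieForm v q = 0) :
    IsRotationSubgroup p q (Submodule.span ℝ {e, v}) (rot e v) where
  finrank_eq := by
    have hr : range ![e, v] = {e, v} := by
      rw [Matrix.range_cons, Matrix.range_cons, Matrix.range_empty, union_empty, singleton_union]
    rw [← hr, finrank_span_eq_card (linearIndependent_of_orthogonal he hev hv), Fintype.card_fin]
  perp_p := by
    intro x hx
    obtain ⟨s, r, rfl⟩ := Submodule.mem_span_pair.1 hx
    simp [hep, hvp]
  perp_q := by
    intro x hx
    obtain ⟨s, r, rfl⟩ := Submodule.mem_span_pair.1 hx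
    simp [heq, hvq]
  continuous := continuous_iff_continuousAt.2 fun θ => (hasDerivAt_rot e v θ).continuousAt
  map_zero := rot_zero e v
  map_add := rot_add e v
  isometry θ := ⟨lieForm_rot e v θ, rot_apply_eq_self (by simp [rotGen_apply, hep, hvp]) θ,
    rot_apply_eq_self (by simp [rotGen_apply, heq, hvq]) θ⟩
  fixes_orthogonal θ x hx := by
    refine rot_apply_eq_self ?_ θ
    rw [rotGen_apply, lieForm_comm e, lieForm_comm v, hx e (Submodule.subset_span (by simp)),
      hx v (Submodule.subset_span (by simp))]
    simp
  nontrivial := by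
    by_contra! h
    have h1 := (hasDerivAt_rot e v 0).clm_apply (hasDerivAt_const 0 e)
    have h2 : HasDerivAt (fun θ => rot e v θ e) 0 0 := by
      simp only [h]
      exact hasDerivAt_const _ _
    have h3 := h1.unique h2
    rw [rot_zero] at h3
    simp [rotGen_apply, he, lieForm_comm v e, hev] at h3
    exact hv h3

/-- A solution of the linear equation `g' = rotGen e v g` is an orbit of the rotations. -/
theorem eq_rot_of_hasDerivAt {e v : LieVec} {g : ℝ → LieVec} {s₀ s₁ : ℝ}
    (hg : ∀ s ∈ Ioo s₀ s₁, HasDerivAt g (rotGen e v (g s)) s) (h0 : (0 : ℝ) ∈ Ioo s₀ s₁) {s : ℝ}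
    (hs : s ∈ Ioo s₀ s₁) : g s = rot e v s (g 0) := by
  have hd : ∀ s ∈ Ioo s₀ s₁, HasDerivAt (fun s => rot e v (-s) (g s)) 0 s := by
    intro s hs
    have h1 : HasDerivAt (fun s => rot e v (-s)) _ s :=
      (hasDerivAt_rot e v (-s)).scomp s (hasDerivAt_neg s)
    refine (h1.clm_apply (hg s hs)).congr_deriv ?_
    simp
  have hc : rot e v (-s) (g s) = rot e v (-0) (g 0) :=
    (convex_Ioo s₀ s₁).is_const_of_fderivWithin_eq_zero (𝕜 := ℝ)
      (fun y hy => (hd y hy).differentiableAt.differentiableWithinAt)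
      (fun y hy => by
        rw [fderivWithin_of_isOpen isOpen_Ioo hy, ← toSpanSingleton_deriv, (hd y hy).deriv]
        simp) hs h0
  have h2 := congrArg (rot e v s) hc
  rw [← ContinuousLinearMap.comp_apply, ← rot_add, neg_zero, rot_zero, add_neg_cancel,
    rot_zero] at h2
  exact h2

/-- A primitive of `1 / (1 + k m²)` near `0`, which recovers the angle of a rotation from its
tangent. -/
theorem exists_angle (k : ℝ) : ∃ (δ : ℝ) (A : ℝ → ℝ), 0 < δ ∧ ContDiffOn ℝ ∞ A (Ioo (-δ) δ) ∧
    (∀ m ∈ Ioo (-δ) δ, 1 + k * m ^ 2 ≠ 0 ∧ HasDerivAt A (1 + k * m ^ 2)⁻¹ m) ∧ A 0 = 0 ∧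
    ∀ m, A m = 0 → m = 0 := by
  -- The integrand is cut off where `1 + k s²` is small, so that it is defined and positive
  -- everywhere.
  set d : ℝ → ℝ := fun s => max (1 + k * s ^ 2) (1 / 2) with hd
  have hd0 : ∀ s, 0 < d s := fun s => lt_of_lt_of_le (by norm_num) (le_max_right _ _)
  have hcont : Continuous fun s => (d s)⁻¹ :=
    Continuous.inv₀ (by fun_prop) (fun s => (hd0 s).ne')
  set A : ℝ → ℝ := fun m => ∫ s in (0 : ℝ)..m, (d s)⁻¹ with hA
  have hAd : ∀ m, HasDerivAt A (d m)⁻¹ m := fun m =>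
    (hcont.integral_hasStrictDerivAt 0 m).hasDerivAt
  have hA0 : A 0 = 0 := by simp [hA]
  have hmono : StrictMono A := strictMono_of_deriv_pos fun m => by
    rw [(hAd m).deriv]; exact inv_pos.2 (hd0 m)
  have hδ : 0 < 1 / (2 * (1 + |k|)) := by positivity
  have hdm : ∀ m ∈ Ioo (-(1 / (2 * (1 + |k|)))) (1 / (2 * (1 + |k|))), d m = 1 + k * m ^ 2 := by
    intro m hm
    refine max_eq_left ?_
    have h1 : |m| < 1 / (2 * (1 + |k|)) := abs_lt.2 hm
    rw [lt_div_iff₀ (by positivity)] at h1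
    have h2 : |m| ≤ 1 := by
      nlinarith [abs_nonneg m, abs_nonneg k, mul_nonneg (abs_nonneg m) (abs_nonneg k)]
    have h3 : |k * m ^ 2| ≤ 1 / 2 := by
      rw [abs_mul, abs_pow]
      nlinarith [abs_nonneg m, abs_nonneg k, mul_nonneg (abs_nonneg m) (abs_nonneg k)]
    linarith [(abs_le.1 h3).1]
  refine ⟨1 / (2 * (1 + |k|)), A, hδ, ?_, ?_, hA0, fun m hm => hmono.injective (hm.trans hA0.symm)⟩
  · rw [contDiffOn_infty_iff_deriv_of_isOpen isOpen_Ioo]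
    refine ⟨fun m _ => (hAd m).differentiableAt.differentiableWithinAt, ?_⟩
    have : ContDiffOn ℝ ∞ (fun m : ℝ => (1 + k * m ^ 2)⁻¹)
        (Ioo (-(1 / (2 * (1 + |k|)))) (1 / (2 * (1 + |k|)))) :=
      ContDiffOn.inv (by fun_prop) fun m hm => by rw [← hdm m hm]; exact (hd0 m).ne'
    refine this.congr fun m hm => ?_
    rw [(hAd m).deriv, hdm m hm]
  · intro m hm
    rw [← hdm m hm]
    exact ⟨(hd0 m).ne', hAd m⟩

namespace ChannelChart

variable {p q : LieVec} {D : Set (ℝ × ℝ)} {F T : ℝ × ℝ → LieVec} {a₁ b₁ a₂ b₂ : ℝ × ℝ → ℝ}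
  {x : ℝ × ℝ}

/-- The first curvature sphere. -/
local notation "σ₁" => combine a₁ b₁ F T

/-- The second curvature sphere. -/
local notation "σ₂" => combine a₂ b₂ F T

/-- The tangent direction of the circular curvature lines. -/
local notation "ω" => combine a₂ b₂ (dirDeriv ((0 : ℝ), (1 : ℝ)) F) (dirDeriv ((0 : ℝ), (1 : ℝ)) T)

/-- The infinitesimal rotation in the plane `⟨ω, ∂₂ ω⟩` is tangent to the circular curvature
lines. -/
theorem exists_rotGen_eq (h : ChannelChart p q D F T a₁ b₁ a₂ b₂) (hp : lieForm p p = -1)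
    (hpq : lieForm p q = 0) {e v : LieVec} (he : lieForm e e = 1) (hev : lieForm e v = 0)
    (hv : v ≠ 0) (hspan : ∀ x ∈ D, Submodule.span ℝ {ω x, ∂₂ ω x} = Submodule.span ℝ {e, v}) :
    ∃ j : ℝ × ℝ → ℝ, ContDiffOn ℝ ∞ j D ∧ ∀ x ∈ D, j x ≠ 0 ∧
      rotGen e v (σ₂ x) = j x • ω x ∧ rotGen e v (F x) = j x • ∂₂ F x ∧
      rotGen e v (T x) = j x • ∂₂ T x := by
  have hpos : ∀ x ∈ D, lieForm (ω x) (ω x) ≠ 0 := fun x hx => (h.ω_pos hp hpq hx).ne'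
  have hAs : ContDiffOn ℝ ∞ (fun x => rotGen e v (σ₂ x)) D :=
    (rotGen e v).contDiff.comp_contDiffOn h.smooth_σ₂
  refine ⟨fun x => lieForm (rotGen e v (σ₂ x)) (ω x) / lieForm (ω x) (ω x),
    (hAs.lieForm h.smooth_ω).div (h.smooth_ω.lieForm h.smooth_ω) hpos, fun x hx => ?_⟩
  have hs := hspan x hx
  have he_mem : e ∈ Submodule.span ℝ {ω x, ∂₂ ω x} := hs ▸ Submodule.subset_span (by simp)
  have hv_mem : v ∈ Submodule.span ℝ {ω x, ∂₂ ω x} := hs ▸ Submodule.subset_span (by simp)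
  have hA₁ : rotGen e v (σ₁ x) = 0 := by
    rw [rotGen_apply, (h.perp_of_mem_span hx he_mem).2.2, (h.perp_of_mem_span hx hv_mem).2.2]
    simp
  have hA₂_mem : rotGen e v (σ₂ x) ∈ Submodule.span ℝ {ω x, ∂₂ ω x} := by
    rw [rotGen_apply]
    exact sub_mem (Submodule.smul_mem _ _ hv_mem) (Submodule.smul_mem _ _ he_mem)
  obtain ⟨s, r, hsr⟩ := Submodule.mem_span_pair.1 hA₂_mem
  have hr : r = 0 := by
    have h1 := lieForm_rotGen e v (σ₂ x) (σ₂ x)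
    rw [lieForm_comm (σ₂ x), ← hsr] at h1
    simp only [map_add, map_smul, LinearMap.add_apply, LinearMap.smul_apply, smul_eq_mul,
      h.ω_perp_σ₂ hx, h.lieForm_dirDeriv_ω_σ₂ hx] at h1
    have h2 : r * lieForm (ω x) (ω x) = 0 := by linarith
    exact (mul_eq_zero.1 h2).resolve_right (hpos x hx)
  rw [hr, zero_smul, add_zero] at hsr
  have hj : lieForm (rotGen e v (σ₂ x)) (ω x) / lieForm (ω x) (ω x) = s := by
    rw [← hsr, map_smul, LinearMap.smul_apply, smul_eq_mul, mul_div_cancel_right₀ _ (hpos x hx)]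
  simp only [hj]
  have hd := h.det_ne x hx
  refine ⟨?_, hsr.symm, ?_, ?_⟩
  · -- The plane is not orthogonal to the second curvature sphere.
    rintro rfl
    rw [zero_smul, rotGen_apply] at hsr
    have h1 : lieForm v (σ₂ x) = 0 := by
      have := congrArg (fun y => lieForm e y) hsr
      simpa [he, hev] using this
    have h2 : lieForm e (σ₂ x) = 0 := by
      rw [h1, zero_smul, sub_zero] at hsr
      exact (smul_eq_zero.1 hsr.symm).resolve_right hv
    have h3 : ∂₂ ω x ∈ Submodule.span ℝ {e, v} := hs ▸ Submodule.subset_span (by simp)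
    obtain ⟨c, d, hcd⟩ := Submodule.mem_span_pair.1 h3
    have h4 := h.lieForm_dirDeriv_ω_σ₂ hx
    rw [← hcd] at h4
    simp [h1, h2] at h4
    exact hpos x hx h4
  · apply smul_right_injective _ hd
    have hF : (a₁ x * b₂ x - a₂ x * b₁ x) • F x = b₂ x • σ₁ x - b₁ x • σ₂ x := by
      unfold combine; module
    change (a₁ x * b₂ x - a₂ x * b₁ x) • rotGen e v (F x)
      = (a₁ x * b₂ x - a₂ x * b₁ x) • s • ∂₂ F x
    rw [← map_smul, hF, map_sub, map_smul, map_smul, hA₁, ← hsr,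
      smul_comm (a₁ x * b₂ x - a₂ x * b₁ x) s (∂₂ F x), h.smul_dirDeriv_F hx]
    module
  · apply smul_right_injective _ hd
    have hT : (a₁ x * b₂ x - a₂ x * b₁ x) • T x = a₁ x • σ₂ x - a₂ x • σ₁ x := by
      unfold combine; module
    change (a₁ x * b₂ x - a₂ x * b₁ x) • rotGen e v (T x)
      = (a₁ x * b₂ x - a₂ x * b₁ x) • s • ∂₂ T x
    rw [← map_smul, hT, map_sub, map_smul, map_smul, hA₁, ← hsr,
      smul_comm (a₁ x * b₂ x - a₂ x * b₁ x) s (∂₂ T x), h.smul_dirDeriv_T hx]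
    module

/-- Near every point there is a rotation angle, measured from the plane orthogonal to a unit
vector `e'` of the plane of rotation. -/
theorem exists_angle_function (h : ChannelChart p q D F T a₁ b₁ a₂ b₂) (hp : lieForm p p = -1)
    (hpq : lieForm p q = 0) {e v : LieVec} (he : lieForm e e = 1) (hev : lieForm e v = 0)
    (hv : v ≠ 0) (hspan : ∀ x ∈ D, Submodule.span ℝ {ω x, ∂₂ ω x} = Submodule.span ℝ {e, v})
    {x₀ : ℝ × ℝ} (hx₀ : x₀ ∈ D) :
    ∃ (e' : LieVec) (O : Set (ℝ × ℝ)) (θ : ℝ × ℝ → ℝ), e' ∈ Submodule.span ℝ {e, v} ∧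
      lieForm e' e' = 1 ∧ IsOpen O ∧ x₀ ∈ O ∧ O ⊆ D ∧ ContDiffOn ℝ ∞ θ O ∧ θ x₀ = 0 ∧
      (∀ x ∈ O, θ x = 0 → lieForm (F x) e' = 0) ∧
      ∀ x ∈ O, ∂₂ θ x ≠ 0 ∧ ∂₂ F x = ∂₂ θ x • rotGen e v (F x) ∧
        ∂₂ T x = ∂₂ θ x • rotGen e v (T x) := by
  obtain ⟨j, hjs, hj⟩ := h.exists_rotGen_eq hp hpq he hev hv hspan
  have hpos := h.ω_pos hp hpq hx₀
  set k := lieForm v v with hk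
  -- The unit vector in the direction of the circle through the given point.
  set e' : LieVec := (√(lieForm (ω x₀) (ω x₀)))⁻¹ • ω x₀ with he'def
  have he' : lieForm e' e' = 1 := by
    simp only [he'def, map_smul, LinearMap.smul_apply, smul_eq_mul]
    rw [← mul_assoc, ← mul_inv, Real.mul_self_sqrt hpos.le, inv_mul_cancel₀ hpos.ne']
  have he'_mem : e' ∈ Submodule.span ℝ {e, v} :=
    hspan x₀ hx₀ ▸ Submodule.smul_mem _ _ (Submodule.subset_span (by simp))
  set v' : LieVec := rotGen e v e' with hv'
  obtain ⟨a, b, hab⟩ := Submodule.mem_span_pair.1 he'_mem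
  have hv'eq : v' = a • v - (b * k) • e := by
    rw [hv', rotGen_apply, ← hab]
    simp [he, hev, lieForm_comm v e, hk]
  have hnorm : a ^ 2 + k * b ^ 2 = 1 := by
    rw [← he', ← hab]
    simp [he, hev, lieForm_comm v e, hk]
    ring
  have hgen : ∀ y, rotGen e v y = lieForm e' y • v' - lieForm v' y • e' := by
    intro y
    rw [rotGen_apply, hv'eq, ← hab]
    simp only [map_add, map_sub, map_smul, LinearMap.add_apply, LinearMap.sub_apply,
      LinearMap.smul_apply, smul_eq_mul]
    match_scalars
    · linear_combination -(lieForm e y) * hnorm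
    · linear_combination (lieForm v y) * hnorm
  have hev' : lieForm e' v' = 0 := by
    rw [hv'eq, ← hab]
    simp [he, hev, lieForm_comm v e, hk]
    ring
  have hvv' : lieForm v' v' = k := by
    rw [hv'eq]
    simp only [map_sub, map_smul, LinearMap.sub_apply, LinearMap.smul_apply, smul_eq_mul, he, hev,
      lieForm_comm v e, ← hk]
    linear_combination k * hnorm
  have hE : ContDiffOn ℝ ∞ (fun x => lieForm (σ₂ x) e') D := h.smooth_σ₂.lieForm contDiffOn_const
  have hV : ContDiffOn ℝ ∞ (fun x => lieForm (σ₂ x) v') D := h.smooth_σ₂.lieForm contDiffOn_const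
  have hσe : lieForm (σ₂ x₀) e' = 0 := by
    rw [he'def, map_smul, lieForm_comm (σ₂ x₀) (ω x₀), h.ω_perp_σ₂ hx₀, smul_zero]
  have hσv : lieForm (σ₂ x₀) v' ≠ 0 := by
    intro h0
    have h1 := (hj x₀ hx₀).2.1
    rw [hgen, lieForm_comm e', lieForm_comm v', hσe, h0, zero_smul, zero_smul, sub_zero] at h1
    exact (smul_ne_zero (hj x₀ hx₀).1 (h.ω_ne_zero hx₀)) h1.symm
  obtain ⟨δ, A, hδ, hA, hAd, hA0, hAinj⟩ := exists_angle k
  -- The tangent of the rotation angle.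
  set m : ℝ × ℝ → ℝ := fun x => -(lieForm (σ₂ x) e' / lieForm (σ₂ x) v') with hm
  have hD₁ : IsOpen (D ∩ (fun x => lieForm (σ₂ x) v') ⁻¹' {0}ᶜ) :=
    hV.continuousOn.isOpen_inter_preimage h.isOpen isOpen_compl_singleton
  set D₁ := D ∩ (fun x => lieForm (σ₂ x) v') ⁻¹' {0}ᶜ with hD₁def
  have hms : ContDiffOn ℝ ∞ m D₁ :=
    ((hE.mono inter_subset_left).div (hV.mono inter_subset_left) fun x hx => hx.2).neg
  have hO : IsOpen (D₁ ∩ m ⁻¹' Ioo (-δ) δ) :=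
    hms.continuousOn.isOpen_inter_preimage hD₁ isOpen_Ioo
  have hm0 : m x₀ = 0 := by simp [hm, hσe]
  refine ⟨e', D₁ ∩ m ⁻¹' Ioo (-δ) δ, fun x => A (m x), he'_mem, he', hO,
    ⟨⟨hx₀, hσv⟩, by rw [mem_preimage, hm0]; exact ⟨neg_lt_zero.2 hδ, hδ⟩⟩,
    fun x hx => hx.1.1, hA.comp (hms.mono inter_subset_left) (fun x hx => hx.2), by simp [hm0, hA0],
    ?_, ?_⟩
  · intro x hx hx0
    have h1 : lieForm (σ₂ x) e' = 0 := by
      have := hAinj _ hx0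
      simp only [hm, neg_eq_zero, div_eq_zero_iff] at this
      exact this.resolve_right hx.1.2
    have h2 : lieForm (σ₁ x) e' = 0 := by
      rw [lieForm_comm]
      exact (h.perp_of_mem_span hx.1.1 ((hspan x hx.1.1).symm ▸ he'_mem)).2.2
    have hF : (a₁ x * b₂ x - a₂ x * b₁ x) • F x = b₂ x • σ₁ x - b₁ x • σ₂ x := by
      unfold combine; module
    have h3 := congrArg (fun y => lieForm y e') hF
    simp [h1, h2] at h3
    exact h3.resolve_left (h.det_ne x hx.1.1)
  · intro x hx
    have hxD : x ∈ D := hx.1.1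
    have hxV : lieForm (σ₂ x) v' ≠ 0 := hx.1.2
    obtain ⟨hj0, hjσ, hjF, hjT⟩ := hj x hxD
    obtain ⟨hAne, hAx⟩ := hAd (m x) hx.2
    have hmx : DifferentiableAt ℝ m x := hms.diffAt hD₁ hx.1
    have hθ : ∂₂ (fun x => A (m x)) x = (1 + k * m x ^ 2)⁻¹ * ∂₂ m x := by
      have hc : HasFDerivAt (fun x => A (m x)) _ x := hAx.comp_hasFDerivAt x hmx.hasFDerivAt
      unfold dirDeriv
      rw [hc.fderiv]
      rfl
    have hdE : j x * ∂₂ (fun x => lieForm (σ₂ x) e') x = -lieForm (σ₂ x) v' := by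
      rw [dirDeriv_lieForm (h.smooth_σ₂.diffAt h.isOpen hxD) (differentiableAt_const e'),
        h.dirDeriv_σ₂ hxD, dirDeriv_const, map_zero, add_zero, ← smul_eq_mul,
        ← LinearMap.smul_apply, ← map_smul, ← hjσ, hgen]
      simp [he', lieForm_comm v' e', hev', lieForm_comm v' (σ₂ x)]
    have hdV : j x * ∂₂ (fun x => lieForm (σ₂ x) v') x = k * lieForm (σ₂ x) e' := by
      rw [dirDeriv_lieForm (h.smooth_σ₂.diffAt h.isOpen hxD) (differentiableAt_const v'),
        h.dirDeriv_σ₂ hxD, dirDeriv_const, map_zero, add_zero, ← smul_eq_mul,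
        ← LinearMap.smul_apply, ← map_smul, ← hjσ, hgen]
      simp [hvv', hev', lieForm_comm e' (σ₂ x), mul_comm]
    have hprod : ∂₂ m x * lieForm (σ₂ x) v' + m x * ∂₂ (fun x => lieForm (σ₂ x) v') x
        = -∂₂ (fun x => lieForm (σ₂ x) e') x := by
      have h1 := dirDeriv_smul (w := ((0 : ℝ), (1 : ℝ))) hmx (hV.diffAt h.isOpen hxD)
      simp only [smul_eq_mul] at h1
      rw [← h1]
      have h2 : EqOn (fun y => m y * lieForm (σ₂ y) v') (fun y => (-1 : ℝ) • lieForm (σ₂ y) e')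
          D₁ := by
        intro y hy
        have : lieForm (σ₂ y) v' ≠ 0 := hy.2
        simp only [hm, smul_eq_mul]
        field_simp
      rw [dirDeriv_congr hD₁ h2 hx.1,
        dirDeriv_smul (a := fun _ => (-1 : ℝ)) (differentiableAt_const _) (hE.diffAt h.isOpen hxD),
        dirDeriv_const]
      simp
    have hmE : m x * lieForm (σ₂ x) v' = -lieForm (σ₂ x) e' := by
      simp only [hm]; field_simp
    have hjm : j x * ∂₂ m x = 1 + k * m x ^ 2 := by
      apply mul_right_cancel₀ hxV
      linear_combination j x * hprod - hdE - m x * hdV - k * m x * hmE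
    have hjθ : ∂₂ (fun x => A (m x)) x * j x = 1 := by
      rw [hθ, mul_assoc, mul_comm _ (j x), hjm, inv_mul_cancel₀ hAne]
    refine ⟨left_ne_zero_of_mul_eq_one hjθ, ?_, ?_⟩
    · rw [hjF, smul_smul, hjθ, one_smul]
    · rw [hjT, smul_smul, hjθ, one_smul]

end ChannelChart

/-! ### Coordinates on a surface -/

section Coordinates

variable {S : Type*} [TopologicalSpace S] [ChartedSpace (EuclideanSpace ℝ (Fin 2)) S]

/-- The inverse function theorem for maps from a parametrised surface to the plane: a map with
injective differential gives new coordinates, defined on a rectangle. -/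
theorem exists_partialDiffeomorph_of_injective {E : Type*} [NormedAddCommGroup E]
    [NormedSpace ℝ E] [FiniteDimensional ℝ E] (hE : Module.finrank ℝ E = 2)
    (Φ : PartialDiffeomorph 𝓘(ℝ, E) (𝓡 2) E S ∞) {G : E → ℝ × ℝ} {O : Set E} {a : E}
    (hO : IsOpen O) (hOΦ : O ⊆ Φ.source) (ha : a ∈ O) (hG : ContDiffOn ℝ ∞ G O)
    (hinj : ∀ w, fderiv ℝ G a w = 0 → w = 0) :
    ∃ (Ψ : PartialDiffeomorph 𝓘(ℝ, ℝ × ℝ) (𝓡 2) (ℝ × ℝ) S ∞) (g : ℝ × ℝ → E) (r₀ r₁ s₀ s₁ : ℝ),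
      Ψ.source = Ioo r₀ r₁ ×ˢ Ioo s₀ s₁ ∧ G a ∈ Ioo r₀ r₁ ×ˢ Ioo s₀ s₁ ∧ g (G a) = a ∧
      MapsTo g (Ioo r₀ r₁ ×ˢ Ioo s₀ s₁) O ∧ ContDiffOn ℝ ∞ g (Ioo r₀ r₁ ×ˢ Ioo s₀ s₁) ∧
      (∀ y ∈ Ioo r₀ r₁ ×ˢ Ioo s₀ s₁, G (g y) = y) ∧ ∀ y, Ψ y = Φ (g y) := by
  have : CompleteSpace E := FiniteDimensional.complete ℝ E
  have hGa : ContDiffAt ℝ ∞ G a := hG.contDiffAt (hO.mem_nhds ha)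
  let L : E ≃L[ℝ] ℝ × ℝ := (LinearEquiv.ofInjectiveOfFinrankEq (fderiv ℝ G a).toLinearMap
    ((injective_iff_map_eq_zero _).2 hinj) (by rw [hE]; simp)).toContinuousLinearEquiv
  have hL : (L : E →L[ℝ] ℝ × ℝ) = fderiv ℝ G a := by ext <;> rfl
  have hGd : HasFDerivAt G (L : E →L[ℝ] ℝ × ℝ) a := by
    rw [hL]; exact (hGa.differentiableAt (by simp)).hasFDerivAt
  set e := hGa.toOpenPartialHomeomorph G hGd (by simp) with he
  have hcont : ContinuousAt (fderiv ℝ G) a :=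
    (hG.continuousOn_fderiv_of_isOpen hO (by simp)).continuousAt (hO.mem_nhds ha)
  -- The differential is invertible near the given point.
  have hev : ∀ᶠ y in 𝓝 a, y ∈ O ∧ y ∈ e.source ∧
      fderiv ℝ G y ∈ range ((↑) : (E ≃L[ℝ] ℝ × ℝ) → E →L[ℝ] ℝ × ℝ) :=
    (hO.eventually_mem ha).and ((e.open_source.eventually_mem
      (hGa.mem_toOpenPartialHomeomorph_source hGd (by simp))).and
      (hcont.eventually (hL ▸ ContinuousLinearEquiv.nhds L)))
  obtain ⟨O', hO', hO'o, haO'⟩ := eventually_nhds_iff.1 hev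
  set e' := e.restrOpen O' hO'o with he'
  have he'src : e'.source = e.source ∩ O' := e.restrOpen_source O' hO'o
  have hae' : a ∈ e'.source := he'src ▸ ⟨(hO' a haO').2.1, haO'⟩
  have htar : G a ∈ e'.target := e'.map_source hae'
  have hsymm : ∀ y ∈ e'.target, e'.symm y ∈ O' := fun y hy =>
    (he'src ▸ e'.map_target hy : e'.symm y ∈ e.source ∩ O').2
  have hsmooth : ContDiffOn ℝ ∞ e'.symm e'.target := by
    intro y hy
    obtain ⟨h1, -, M, hM⟩ := hO' _ (hsymm y hy)
    have hc : ContDiffAt ℝ ∞ G (e'.symm y) := hG.contDiffAt (hO.mem_nhds h1)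
    refine (e'.contDiffAt_symm (f₀' := M) hy ?_ hc).contDiffWithinAt
    rw [hM]
    exact (hc.differentiableAt (by simp)).hasFDerivAt
  obtain ⟨U, V, hU, hUa, hV, hVa, hUV⟩ := mem_nhds_prod_iff'.1 (e'.open_target.mem_nhds htar)
  obtain ⟨r₀, r₁, hr, hrU⟩ := mem_nhds_iff_exists_Ioo_subset.1 (hU.mem_nhds hUa)
  obtain ⟨s₀, s₁, hs, hsV⟩ := mem_nhds_iff_exists_Ioo_subset.1 (hV.mem_nhds hVa)
  set B := Ioo r₀ r₁ ×ˢ Ioo s₀ s₁ with hB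
  have hBt : B ⊆ e'.target := (prod_mono hrU hsV).trans hUV
  have hBo : IsOpen B := isOpen_Ioo.prod isOpen_Ioo
  set e'' := e'.symm.restrOpen B hBo with he''
  have hsrc : e''.source = B := by
    rw [he'', e'.symm.restrOpen_source B hBo]
    exact inter_eq_right.2 hBt
  have htgt : e''.target ⊆ O' := fun y hy => by
    have h1 := hsymm (e''.symm y) (hBt (hsrc ▸ e''.map_target hy))
    have h2 : e'.symm (e''.symm y) = y := e''.right_inv hy
    rwa [h2] at h1
  let Ψ₀ : PartialDiffeomorph 𝓘(ℝ, ℝ × ℝ) 𝓘(ℝ, E) (ℝ × ℝ) E ∞ :=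
    { toPartialEquiv := e''.toPartialEquiv
      open_source := e''.open_source
      open_target := e''.open_target
      contMDiffOn_toFun := (hsmooth.mono (hsrc.trans_subset hBt)).contMDiffOn
      contMDiffOn_invFun := (hG.mono fun y hy => (hO' y (htgt hy)).1).contMDiffOn }
  refine ⟨Ψ₀.trans Φ, e'.symm, r₀, r₁, s₀, s₁, ?_, ⟨hr, hs⟩, e'.left_inv hae',
    fun y hy => (hO' _ (hsymm y (hBt hy))).1, hsmooth.mono hBt, fun y hy => e'.right_inv (hBt hy),
    fun y => rfl⟩
  change e''.source ∩ e'' ⁻¹' Φ.source = B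
  rw [hsrc]
  exact inter_eq_left.2 fun y hy => hOΦ (hO' _ (hsymm y (hBt hy))).1

/-- A parametrisation identifies its parameter space with the tangent spaces of the surface, and
derivatives of the parametrised map with differentials. -/
theorem PartialDiffeomorph.exists_tangentEquiv {E : Type*} [NormedAddCommGroup E]
    [NormedSpace ℝ E] (Φ : PartialDiffeomorph 𝓘(ℝ, E) (𝓡 2) E S ∞) {a : E} (ha : a ∈ Φ.source) :
    ∃ L : E ≃L[ℝ] TangentSpace (𝓡 2) (Φ a), ∀ g : S → LieVec,
      ContMDiff (𝓡 2) 𝓘(ℝ, LieVec) ∞ g →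
      ∀ w, lieDiff g (Φ a) (L w) = fderiv ℝ (fun y => g (Φ y)) a w := by
  refine ⟨(Φ.isLocalDiffeomorphAt 𝓘(ℝ, E) (𝓡 2) ∞ ha).mfderivToContinuousLinearEquiv (by simp),
    fun g hg w => ?_⟩
  have h1 := mfderiv_comp (I := 𝓘(ℝ, E)) (I' := 𝓡 2) (I'' := 𝓘(ℝ, LieVec)) a
    (hg.mdifferentiable (by simp) (Φ a)) (Φ.mdifferentiableAt (by simp) ha)
  rw [mfderiv_eq_fderiv] at h1
  exact (congrArg (fun m => m w) h1).symm

/-- The inverse of a chart of a smooth surface. -/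
noncomputable def chartParametrisation [IsManifold (𝓡 2) ∞ S] (x : S) :
    PartialDiffeomorph 𝓘(ℝ, EuclideanSpace ℝ (Fin 2)) (𝓡 2) (EuclideanSpace ℝ (Fin 2)) S ∞ where
  toPartialEquiv := (extChartAt (𝓡 2) x).symm
  open_source := isOpen_extChartAt_target x
  open_target := isOpen_extChartAt_source x
  contMDiffOn_toFun := contMDiffOn_extChartAt_symm x
  contMDiffOn_invFun := by
    have := contMDiffOn_extChartAt (I := 𝓡 2) (n := ∞) (x := x)
    rwa [← extChartAt_source (𝓡 2)] at this

end Coordinates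

section Surfaces

variable {S : Type*} [TopologicalSpace S] [ChartedSpace (EuclideanSpace ℝ (Fin 2)) S]
  {p q : LieVec} {f t : S → LieVec}

/-- The coefficients of a sphere of the contact element `⟨f, t⟩`. -/
theorem IsSpaceFormSurface.eq_of_mem (h : IsSpaceFormSurface p q f t) {x : S} {y : LieVec}
    (hy : y ∈ legendreLift f t x) : y = (-lieForm y q) • f x + (-lieForm y p) • t x := by
  obtain ⟨c, d, rfl⟩ := Submodule.mem_span_pair.1 hy
  simp [(h.mem_f x).2.1, (h.mem_f x).2.2, (h.mem_t x).2.1, (h.mem_t x).2.2]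

theorem IsSpaceFormSurface.eq_zero_of_mem (h : IsSpaceFormSurface p q f t) {x : S} {y : LieVec}
    (hy : y ∈ legendreLift f t x) (hyp : lieForm y p = 0) (hyq : lieForm y q = 0) : y = 0 := by
  rw [h.eq_of_mem hy, hyp, hyq]
  simp

/-- At a point without umbilics there is a curvature sphere different from a given one. -/
theorem UmbilicFree.exists_isCurvatureSphere (h : UmbilicFree f t) (x : S) {σ : LieVec}
    (hσ : σ ≠ 0) : ∃ τ, IsCurvatureSphere f t x τ ∧ LinearIndependent ℝ ![σ, τ] := by
  obtain ⟨σ₁, σ₂, h₁, h₂, h12⟩ := h x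
  by_contra! hne
  have k₁ := hne σ₁ h₁
  have k₂ := hne σ₂ h₂
  rw [LinearIndependent.pair_iff' hσ] at k₁ k₂
  push Not at k₁ k₂
  obtain ⟨c, rfl⟩ := k₁
  obtain ⟨d, rfl⟩ := k₂
  have := (LinearIndependent.pair_iff.1 h12) d (-c) (by module)
  apply h₁.1
  rw [neg_eq_zero.1 this.2, zero_smul]

end Surfaces

/-! ### Curvature line coordinates of a channel linear Weingarten surface -/

section Charts

variable {S : Type*} [TopologicalSpace S] [ChartedSpace (EuclideanSpace ℝ (Fin 2)) S]
  {p q : LieVec} {f t : S → LieVec}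

/-- The parameter of the family of spheres that is enveloped by a channel surface has no critical
points: at a critical point the enveloped sphere would be the only curvature sphere. -/
theorem fderiv_ne_zero_of_channel (h : IsSpaceFormSurface p q f t) (humb : UmbilicFree f t)
    {E : Type*} [NormedAddCommGroup E] [NormedSpace ℝ E]
    (Φ : PartialDiffeomorph 𝓘(ℝ, E) (𝓡 2) E S ∞) {O : Set E} (hO : IsOpen O) (hOΦ : O ⊆ Φ.source)
    {I : Set ℝ} (hI : IsOpen I) {u : E → ℝ} (hu : ContDiffOn ℝ ∞ u O) (huI : MapsTo u O I)
    {σ : ℝ → LieVec} (hσ : ContDiffOn ℝ ∞ σ I) (hσ0 : ∀ τ ∈ I, σ τ ≠ 0)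
    (hmem : ∀ y ∈ O, σ (u y) ∈ legendreLift f t (Φ y)) {a : E} (ha : a ∈ O) :
    fderiv ℝ u a ≠ 0 := by
  intro h0
  obtain ⟨L, hL⟩ := Φ.exists_tangentEquiv (hOΦ ha)
  have hua : HasFDerivAt u (0 : E →L[ℝ] ℝ) a := by
    rw [← h0]
    exact ((hu.contDiffAt (hO.mem_nhds ha)).differentiableAt (by simp)).hasFDerivAt
  have hσa : DifferentiableAt ℝ σ (u a) :=
    (hσ.contDiffAt (hI.mem_nhds (huI ha))).differentiableAt (by simp)
  have hcrit : ∀ {V : Type} [NormedAddCommGroup V] [NormedSpace ℝ V] (φ : ℝ → V),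
      DifferentiableAt ℝ φ (u a) → HasFDerivAt (fun y => φ (u y)) (0 : E →L[ℝ] V) a := by
    intro V _ _ φ hφ
    have := hφ.hasFDerivAt.comp a hua
    rwa [ContinuousLinearMap.comp_zero] at this
  set α : ℝ → ℝ := fun τ => -lieForm (σ τ) q with hα
  set β : ℝ → ℝ := fun τ => -lieForm (σ τ) p with hβ
  have hαd : DifferentiableAt ℝ α (u a) :=
    ((lieFormL.flip q).differentiableAt.comp (u a) hσa).neg
  have hβd : DifferentiableAt ℝ β (u a) :=
    ((lieFormL.flip p).differentiableAt.comp (u a) hσa).neg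
  have hdF : ∀ g : S → LieVec, ContMDiff (𝓡 2) 𝓘(ℝ, LieVec) ∞ g →
      HasFDerivAt (fun y => g (Φ y)) (fderiv ℝ (fun y => g (Φ y)) a) a := by
    intro g hg
    have h1 : ContMDiffAt 𝓘(ℝ, E) 𝓘(ℝ, LieVec) ∞ (fun y => g (Φ y)) a :=
      (hg (Φ a)).comp a (Φ.contMDiffOn.contMDiffAt (Φ.open_source.mem_nhds (hOΦ ha)))
    exact (h1.contDiffAt.differentiableAt (by simp)).hasFDerivAt
  have hexp : ∀ y ∈ O, σ (u y) = α (u y) • f (Φ y) + β (u y) • t (Φ y) := fun y hy =>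
    h.eq_of_mem (hmem y hy)
  have hcomb : ∀ X, α (u a) • lieDiff f (Φ a) X + β (u a) • lieDiff t (Φ a) X = 0 := by
    intro X
    obtain ⟨w, rfl⟩ := L.surjective X
    rw [hL f h.smooth_f, hL t h.smooth_t]
    have h1 := ((hcrit α hαd).smul (hdF f h.smooth_f)).add
      ((hcrit β hβd).smul (hdF t h.smooth_t))
    have h2 : HasFDerivAt (fun y => α (u y) • f (Φ y) + β (u y) • t (Φ y))
        (0 : E →L[ℝ] LieVec) a :=
      (hcrit σ hσa).congr_of_eventuallyEq
        (Filter.eventuallyEq_of_mem (hO.mem_nhds ha) fun y hy => (hexp y hy).symm)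
    simpa using congrArg (fun m => m w) (h1.unique h2)
  obtain ⟨τ, ⟨-, α', β', rfl, X, hX, hτ⟩, hli⟩ :=
    humb.exists_isCurvatureSphere (Φ a) (hσ0 _ (huI ha))
  have hdet : α (u a) * β' - β (u a) * α' ≠ 0 := by
    intro hd
    rw [hexp a ha, LinearIndependent.pair_iff] at hli
    have h1 := hli α' (-α (u a)) (by
      have : β (u a) * α' = α (u a) * β' := by linarith
      match_scalars
      · ring
      · linarith)
    have h2 := hli β' (-β (u a)) (by
      match_scalars
      · linarith
      · ring)
    apply hσ0 _ (huI ha)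
    rw [hexp a ha, neg_eq_zero.1 h1.2, neg_eq_zero.1 h2.2]
    simp
  have hX' := hcomb X
  have hFX : (α (u a) * β' - β (u a) * α') • lieDiff f (Φ a) X ∈ legendreLift f t (Φ a) := by
    have : (α (u a) * β' - β (u a) * α') • lieDiff f (Φ a) X
        = (-β (u a)) • (α' • lieDiff f (Φ a) X + β' • lieDiff t (Φ a) X) := by
      linear_combination (norm := module) β' • hX'
    rw [this]
    exact Submodule.smul_mem _ _ hτ
  have hTX : (α (u a) * β' - β (u a) * α') • lieDiff t (Φ a) X ∈ legendreLift f t (Φ a) := by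
    have : (α (u a) * β' - β (u a) * α') • lieDiff t (Φ a) X
        = α (u a) • (α' • lieDiff f (Φ a) X + β' • lieDiff t (Φ a) X) := by
      linear_combination (norm := module) -α' • hX'
    rw [this]
    exact Submodule.smul_mem _ _ hτ
  exact hX (h.immersion _ X ((Submodule.smul_mem_iff _ hdet).1 hFX)
    ((Submodule.smul_mem_iff _ hdet).1 hTX))

/-- In coordinates `(u, v)` of a linear Weingarten surface that envelops the spheres `σ(u)`, both
curvature spheres have coefficients that depend on `u` only. -/
theorem channelChart_of_family (h : IsSpaceFormSurface p q f t) (humb : UmbilicFree f t)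
    {a b c : ℝ} (habc : a * c - b ^ 2 ≠ 0) (hW : SatisfiesWeingarten p q f t a b c)
    (Φ : PartialDiffeomorph 𝓘(ℝ, ℝ × ℝ) (𝓡 2) (ℝ × ℝ) S ∞) {I : Set ℝ} (hI : IsOpen I)
    {σ : ℝ → LieVec} (hσ : ContDiffOn ℝ ∞ σ I) (hσ0 : ∀ τ ∈ I, σ τ ≠ 0)
    (hΦI : ∀ y ∈ Φ.source, y.1 ∈ I) (hmem : ∀ y ∈ Φ.source, σ y.1 ∈ legendreLift f t (Φ y)) :
    ∃ a₁ b₁ a₂ b₂ : ℝ × ℝ → ℝ,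
      ChannelChart p q Φ.source (fun y => f (Φ y)) (fun y => t (Φ y)) a₁ b₁ a₂ b₂ ∧
      ∀ y ∈ Φ.source, combine a₁ b₁ (fun y => f (Φ y)) (fun y => t (Φ y)) y = σ y.1 := by
  set D := Φ.source with hDdef
  have hD : IsOpen D := Φ.open_source
  set F : ℝ × ℝ → LieVec := fun y => f (Φ y) with hF
  set T : ℝ × ℝ → LieVec := fun y => t (Φ y) with hT
  have hFs : ContDiffOn ℝ ∞ F D :=
    (h.smooth_f.comp_contMDiffOn Φ.contMDiffOn).contDiffOn
  have hTs : ContDiffOn ℝ ∞ T D :=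
    (h.smooth_t.comp_contMDiffOn Φ.contMDiffOn).contDiffOn
  set α : ℝ → ℝ := fun τ => -lieForm (σ τ) q with hα
  set β : ℝ → ℝ := fun τ => -lieForm (σ τ) p with hβ
  have hαs : ContDiffOn ℝ ∞ α I := ((lieFormL.flip q).contDiff.comp_contDiffOn hσ).neg
  have hβs : ContDiffOn ℝ ∞ β I := ((lieFormL.flip p).contDiff.comp_contDiffOn hσ).neg
  -- The second sphere is conjugate to the first one with respect to the Weingarten form.
  set α' : ℝ → ℝ := fun τ => b * α τ + c * β τ with hα'
  set β' : ℝ → ℝ := fun τ => -(a * α τ + b * β τ) with hβ'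
  have hαs' : ContDiffOn ℝ ∞ α' I :=
    (contDiffOn_const.mul hαs).add (contDiffOn_const.mul hβs)
  have hβs' : ContDiffOn ℝ ∞ β' I :=
    ((contDiffOn_const.mul hαs).add (contDiffOn_const.mul hβs)).neg
  have lift : ∀ {φ : ℝ → ℝ}, ContDiffOn ℝ ∞ φ I → ContDiffOn ℝ ∞ (fun y : ℝ × ℝ => φ y.1) D :=
    fun hφ => hφ.comp contDiff_fst.contDiffOn hΦI
  have diff : ∀ {V : Type} [NormedAddCommGroup V] [NormedSpace ℝ V] {φ : ℝ → V},
      ContDiffOn ℝ ∞ φ I → ∀ y ∈ D, ∂₂ (fun y => φ y.1) y = 0 := fun hφ y hy =>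
    dirDeriv_comp_fst ((hφ.contDiffAt (hI.mem_nhds (hΦI y hy))).differentiableAt (by simp))
  have hexp : ∀ y ∈ D, combine (fun y => α y.1) (fun y => β y.1) F T y = σ y.1 := fun y hy =>
    (h.eq_of_mem (hmem y hy)).symm
  have hab : ∀ y ∈ D, α y.1 = 0 → β y.1 = 0 → False := by
    intro y hy h1 h2
    apply hσ0 _ (hΦI y hy)
    rw [← hexp y hy]
    simp [combine, h1, h2]
  have hsph₁ : ∀ y ∈ D, combine (fun y => α y.1) (fun y => β y.1) (∂₂ F) (∂₂ T) y = 0 := by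
    intro y hy
    have h1 := dirDeriv_combine hD (lift hαs) (lift hβs) hFs hTs hy (0, 1)
    rw [dirDeriv_congr hD hexp hy, diff hσ y hy] at h1
    simpa [combine, diff hαs y hy, diff hβs y hy] using h1.symm
  have hder : ∀ y ∈ D, ∃ L : (ℝ × ℝ) ≃L[ℝ] TangentSpace (𝓡 2) (Φ y),
      ∀ w, lieDiff f (Φ y) (L w) = dirDeriv w F y ∧ lieDiff t (Φ y) (L w) = dirDeriv w T y := by
    intro y hy
    obtain ⟨L, hL⟩ := Φ.exists_tangentEquiv hy
    exact ⟨L, fun w => ⟨hL f h.smooth_f w, hL t h.smooth_t w⟩⟩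
  have himm : ∀ y ∈ D, ∀ w, dirDeriv w F y = 0 → dirDeriv w T y = 0 → w = 0 := by
    intro y hy w h1 h2
    obtain ⟨L, hL⟩ := hder y hy
    have := h.immersion (Φ y) (L w) (by rw [(hL w).1, h1]; exact zero_mem _)
      (by rw [(hL w).2, h2]; exact zero_mem _)
    simpa using this
  -- The coefficients of the other curvature sphere.
  have hother : ∀ y ∈ D, ∃ γ δ : ℝ, ∃ w : ℝ × ℝ, w ≠ 0 ∧ α y.1 * δ - β y.1 * γ ≠ 0 ∧
      γ * β' y.1 = δ * α' y.1 ∧ γ • dirDeriv w F y + δ • dirDeriv w T y = 0 := by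
    intro y hy
    obtain ⟨L, hL⟩ := hder y hy
    obtain ⟨τ, hτ, hli⟩ := humb.exists_isCurvatureSphere (Φ y) (hσ0 _ (hΦI y hy))
    have hσc : IsCurvatureSphere f t (Φ y) (σ y.1) := by
      refine ⟨hσ0 _ (hΦI y hy), α y.1, β y.1, (hexp y hy).symm, L (0, 1), ?_, ?_⟩
      · rw [Ne, L.map_eq_zero_iff]; simp
      · rw [(hL _).1, (hL _).2]
        have := hsph₁ y hy
        unfold combine at this
        rw [this]
        exact zero_mem _
    have hWy := hW (Φ y) (σ y.1) τ hσc hτ hli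
    obtain ⟨-, γ, δ, rfl, X, hX, hXm⟩ := hτ
    obtain ⟨w, rfl⟩ := L.surjective X
    rw [(hL w).1, (hL w).2] at hXm
    have hFt := h.mem_f (Φ y)
    have hTt := h.mem_t (Φ y)
    refine ⟨γ, δ, w, fun hw => hX (by rw [hw, map_zero]), ?_, ?_, ?_⟩
    · intro hd
      rw [← hexp y hy, LinearIndependent.pair_iff] at hli
      have h1 := hli γ (-α y.1) (by
        simp only [combine, hF, hT]
        match_scalars
        · ring
        · linarith)
      have h2 := hli δ (-β y.1) (by
        simp only [combine, hF, hT]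
        match_scalars
        · linarith
        · ring)
      exact hab y hy (neg_eq_zero.1 h1.2) (neg_eq_zero.1 h2.2)
    · simp only [map_add, map_smul, LinearMap.add_apply, LinearMap.smul_apply, smul_eq_mul,
        hFt.2.1, hFt.2.2, hTt.2.1, hTt.2.2] at hWy
      simp only [hα', hβ', hα, hβ]
      linear_combination -hWy
    · refine h.eq_zero_of_mem hXm ?_ ?_
      · have e1 := lieForm_dirDeriv_eq_zero hD hFs (fun z _ => (h.mem_f (Φ z)).2.1) hy w
        have e2 := lieForm_dirDeriv_eq_zero hD hTs (fun z _ => (h.mem_t (Φ z)).2.1) hy w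
        simp [e1, e2]
      · have e1 := lieForm_dirDeriv_eq_zero hD hFs (fun z _ => (h.mem_f (Φ z)).2.2) hy w
        have e2 := lieForm_dirDeriv_eq_zero hD hTs (fun z _ => (h.mem_t (Φ z)).2.2) hy w
        simp [e1, e2]
  have hab' : ∀ y ∈ D, α' y.1 = 0 → β' y.1 = 0 → False := by
    intro y hy h1 h2
    simp only [hα', hβ'] at h1 h2
    refine hab y hy ?_ ?_
    · exact (mul_eq_zero.1 (by linear_combination -c * h2 - b * h1 :
        (a * c - b ^ 2) * α y.1 = 0)).resolve_left habc
    · exact (mul_eq_zero.1 (by linear_combination a * h1 + b * h2 :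
        (a * c - b ^ 2) * β y.1 = 0)).resolve_left habc
  have hdet : ∀ y ∈ D, α y.1 * β' y.1 - α' y.1 * β y.1 ≠ 0 := by
    intro y hy hd
    obtain ⟨γ, δ, w, -, hdet, hγδ, -⟩ := hother y hy
    refine hab' y hy ?_ ?_
    · exact (mul_eq_zero.1 (by linear_combination -α y.1 * hγδ + γ * hd :
        (α y.1 * δ - β y.1 * γ) * α' y.1 = 0)).resolve_left hdet
    · exact (mul_eq_zero.1 (by linear_combination -β y.1 * hγδ + δ * hd :
        (α y.1 * δ - β y.1 * γ) * β' y.1 = 0)).resolve_left hdet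
  refine ⟨fun y => α y.1, fun y => β y.1, fun y => α' y.1, fun y => β' y.1,
    { isOpen := hD
      smooth_F := hFs
      smooth_T := hTs
      smooth_a₁ := lift hαs
      smooth_b₁ := lift hβs
      smooth_a₂ := lift hαs'
      smooth_b₂ := lift hβs'
      deriv_a₁ := diff hαs
      deriv_b₁ := diff hβs
      deriv_a₂ := diff hαs'
      deriv_b₂ := diff hβs'
      mem_F := fun y _ => h.mem_f _
      mem_T := fun y _ => h.mem_t _
      incident := fun y _ => h.incident _
      contact := ?_
      immersion := himm
      det_ne := hdet
      sphere₁ := hsph₁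
      sphere₂ := ?_ }, hexp⟩
  · intro y hy w
    obtain ⟨L, hL⟩ := hder y hy
    rw [← (hL w).1]
    exact h.contact _ _
  · intro y hy
    obtain ⟨γ, δ, w, hw, hd, hγδ, hw0⟩ := hother y hy
    rw [dirDeriv_eq w F, dirDeriv_eq w T] at hw0
    have hγδ0 : γ ≠ 0 ∨ δ ≠ 0 := by
      by_contra! h0
      exact hd (by rw [h0.1, h0.2]; ring)
    have hw1 : w.1 • combine (fun y => α' y.1) (fun y => β' y.1) (∂₁ F) (∂₁ T) y
        + w.2 • combine (fun y => α' y.1) (fun y => β' y.1) (∂₂ F) (∂₂ T) y = 0 := by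
      unfold combine
      rcases hγδ0 with h0 | h0
      · apply smul_right_injective _ h0
        simp only [smul_zero]
        linear_combination (norm := skip) α' y.1 • hw0
          + hγδ • (w.1 • ∂₁ T y + w.2 • ∂₂ T y)
        module
      · apply smul_right_injective _ h0
        simp only [smul_zero]
        linear_combination (norm := skip) β' y.1 • hw0
          - hγδ • (w.1 • ∂₁ F y + w.2 • ∂₂ F y)
        module
    have hw10 : w.1 ≠ 0 := by
      intro h1
      have hw20 : w.2 ≠ 0 := fun h2 => hw (Prod.ext h1 h2)
      rw [h1, zero_smul, zero_add, smul_eq_zero] at hw1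
      have e1 := hw1.resolve_left hw20
      have e2 := hsph₁ y hy
      unfold combine at e1 e2
      have hd := hdet y hy
      have := himm y hy (0, 1)
        ((smul_eq_zero.1 (by linear_combination (norm := module) β' y.1 • e2 - β y.1 • e1 :
          (α y.1 * β' y.1 - α' y.1 * β y.1) • ∂₂ F y = 0)).resolve_left hd)
        ((smul_eq_zero.1 (by linear_combination (norm := module) α y.1 • e1 - α' y.1 • e2 :
          (α y.1 * β' y.1 - α' y.1 * β y.1) • ∂₂ T y = 0)).resolve_left hd)
      simp at this
    refine ⟨-(w.2 / w.1), ?_⟩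
    apply smul_right_injective _ hw10
    simp only [smul_smul]
    rw [mul_neg, mul_div_cancel₀ _ hw10]
    linear_combination (norm := module) hw1

/-- Around every point of an umbilic-free non-tubular linear Weingarten surface that envelops the
sphere congruence `s` there are curvature line coordinates in which `s` is the first curvature
sphere. -/
theorem exists_channelChart [IsManifold (𝓡 2) ∞ S] (h : IsSpaceFormSurface p q f t)
    (humb : UmbilicFree f t) {a b c : ℝ} (habc : a * c - b ^ 2 ≠ 0)
    (hW : SatisfiesWeingarten p q f t a b c) {s : S → Submodule ℝ LieVec}
    (hs : ∀ x, s x ≤ legendreLift f t x) {x : S}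
    (hloc : ∃ (U : Set S) (I : Set ℝ) (u : S → ℝ) (σ : ℝ → LieVec),
      IsOpen U ∧ x ∈ U ∧ IsOpen I ∧ MapsTo u U I ∧
      ContMDiffOn (𝓡 2) 𝓘(ℝ, ℝ) ∞ u U ∧ ContDiffOn ℝ ∞ σ I ∧ (∀ τ ∈ I, σ τ ≠ 0) ∧
      ∀ y ∈ U, s y = Submodule.span ℝ {σ (u y)}) :
    ∃ (Φ : PartialDiffeomorph 𝓘(ℝ, ℝ × ℝ) (𝓡 2) (ℝ × ℝ) S ∞) (a₁ b₁ a₂ b₂ : ℝ × ℝ → ℝ)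
      (y : ℝ × ℝ), y ∈ Φ.source ∧ Φ y = x ∧
      ChannelChart p q Φ.source (fun y => f (Φ y)) (fun y => t (Φ y)) a₁ b₁ a₂ b₂ ∧
      ∀ y ∈ Φ.source,
        s (Φ y) = Submodule.span ℝ {combine a₁ b₁ (fun y => f (Φ y)) (fun y => t (Φ y)) y} := by
  obtain ⟨U, I, u, σ, hU, hx, hI, huI, hu, hσ, hσ0, hsσ⟩ := hloc
  set Φ₀ := chartParametrisation x with hΦ₀
  set y₀ := extChartAt (𝓡 2) x x with hy₀
  have hy₀s : y₀ ∈ Φ₀.source := mem_extChartAt_target x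
  have hy₀x : Φ₀ y₀ = x := extChartAt_to_inv x
  have hmemU : ∀ y ∈ U, σ (u y) ∈ legendreLift f t y := fun y hy =>
    hs y (hsσ y hy ▸ Submodule.mem_span_singleton_self _)
  set O := Φ₀.source ∩ Φ₀ ⁻¹' U with hOdef
  have hO : IsOpen O := Φ₀.contMDiffOn.continuousOn.isOpen_inter_preimage Φ₀.open_source hU
  have hy₀O : y₀ ∈ O := ⟨hy₀s, by rw [mem_preimage, hy₀x]; exact hx⟩
  have huO : ContDiffOn ℝ ∞ (fun y => u (Φ₀ y)) O :=
    (hu.comp (Φ₀.contMDiffOn.mono inter_subset_left) (fun y hy => hy.2)).contDiffOn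
  have hne := fderiv_ne_zero_of_channel h humb Φ₀ hO inter_subset_left hI huO
    (fun y hy => huI hy.2) hσ hσ0 (fun y hy => hmemU _ hy.2) hy₀O
  set l := fderiv ℝ (fun y => u (Φ₀ y)) y₀ with hl
  -- The parameter of the family of spheres is completed to coordinates by a linear function.
  set e₀ : EuclideanSpace ℝ (Fin 2) := EuclideanSpace.single 0 1 with he₀
  set e₁ : EuclideanSpace ℝ (Fin 2) := EuclideanSpace.single 1 1 with he₁
  have hdecomp : ∀ w : EuclideanSpace ℝ (Fin 2), w = w 0 • e₀ + w 1 • e₁ := by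
    intro w
    ext i
    fin_cases i <;> simp [he₀, he₁]
  have hlw : ∀ w : EuclideanSpace ℝ (Fin 2), l w = w 0 * l e₀ + w 1 * l e₁ := by
    intro w
    conv_lhs => rw [hdecomp w]
    simp
  have hlpos : l e₀ ^ 2 + l e₁ ^ 2 ≠ 0 := by
    intro h0
    apply hne
    ext w
    have h1 : l e₀ = 0 := by nlinarith [sq_nonneg (l e₀), sq_nonneg (l e₁)]
    have h2 : l e₁ = 0 := by nlinarith [sq_nonneg (l e₀), sq_nonneg (l e₁)]
    rw [hlw, h1, h2]
    simp
  set k : EuclideanSpace ℝ (Fin 2) →L[ℝ] ℝ :=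
    l e₀ • EuclideanSpace.proj 1 - l e₁ • EuclideanSpace.proj 0 with hk
  have hkw : ∀ w, k w = l e₀ * w 1 - l e₁ * w 0 := fun w => by simp [hk]
  have hGd : HasFDerivAt (fun y => (u (Φ₀ y), k y)) (l.prod k) y₀ :=
    (huO.contDiffAt (hO.mem_nhds hy₀O)).differentiableAt (by simp) |>.hasFDerivAt.prodMk
      k.hasFDerivAt
  obtain ⟨Φ, g, r₀, r₁, s₀, s₁, hsrc, hy, hgy, hgO, -, hGg, hΦ⟩ :=
    exists_partialDiffeomorph_of_injective (by simp) Φ₀ hO inter_subset_left hy₀O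
      (huO.prodMk k.contDiff.contDiffOn) (by
        intro w hw
        rw [hGd.fderiv] at hw
        have h1 : l w = 0 := congrArg Prod.fst hw
        have h2 : k w = 0 := congrArg Prod.snd hw
        rw [hlw] at h1
        rw [hkw] at h2
        have h3 : w 0 = 0 := (mul_eq_zero.1 (by linear_combination l e₀ * h1 - l e₁ * h2 :
          (l e₀ ^ 2 + l e₁ ^ 2) * w 0 = 0)).resolve_left hlpos
        have h4 : w 1 = 0 := (mul_eq_zero.1 (by linear_combination l e₁ * h1 + l e₀ * h2 :
          (l e₀ ^ 2 + l e₁ ^ 2) * w 1 = 0)).resolve_left hlpos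
        rw [hdecomp w, h3, h4]
        simp)
  have hΦU : ∀ y ∈ Φ.source, Φ y ∈ U := fun y hy => by
    rw [hsrc] at hy
    rw [hΦ]
    exact (hgO hy).2
  have huΦ : ∀ y ∈ Φ.source, u (Φ y) = y.1 := fun y hy => by
    rw [hsrc] at hy
    rw [hΦ]
    exact congrArg Prod.fst (hGg y hy)
  obtain ⟨a₁, b₁, a₂, b₂, hc, hσc⟩ := channelChart_of_family h humb habc hW Φ hI hσ hσ0
    (fun y hy => huΦ y hy ▸ huI (hΦU y hy)) (fun y hy => huΦ y hy ▸ hmemU _ (hΦU y hy))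
  refine ⟨Φ, a₁, b₁, a₂, b₂, _, hsrc ▸ hy, ?_, hc, fun y hy => ?_⟩
  · rw [hΦ, hgy, hy₀x]
  · rw [hσc y hy, hsσ _ (hΦU y hy), huΦ y hy]

end Charts

/-! ### The axis plane -/

section AxisPlane

variable {S : Type*} [TopologicalSpace S] {p q : LieVec} {s : S → Submodule ℝ LieVec}

/-- The 2-plane `P` is orthogonal to `p`, `q` and, near the point `x`, to the sphere congruence
`s`. -/
def IsAxisPlane (p q : LieVec) (s : S → Submodule ℝ LieVec) (x : S) (P : Submodule ℝ LieVec) :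
    Prop :=
  Module.finrank ℝ P = 2 ∧ (∀ y ∈ P, lieForm y p = 0 ∧ lieForm y q = 0) ∧
    ∀ᶠ x' in 𝓝 x, ∀ y ∈ P, ∀ z ∈ s x', lieForm y z = 0

theorem IsAxisPlane.eventually {x : S} {P : Submodule ℝ LieVec} (h : IsAxisPlane p q s x P) :
    ∀ᶠ x' in 𝓝 x, IsAxisPlane p q s x' P := by
  filter_upwards [eventually_eventually_nhds.2 h.2.2] with x' hx'
  exact ⟨h.1, h.2.1, hx'⟩

/-- In a curvature line chart, the axis plane is the plane of the circular curvature lines. -/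
theorem isAxisPlane_iff [ChartedSpace (EuclideanSpace ℝ (Fin 2)) S]
    (hp : lieForm p p = -1) (hpq : lieForm p q = 0)
    (Φ : PartialDiffeomorph 𝓘(ℝ, ℝ × ℝ) (𝓡 2) (ℝ × ℝ) S ∞) {F T : ℝ × ℝ → LieVec}
    {a₁ b₁ a₂ b₂ : ℝ × ℝ → ℝ} (h : ChannelChart p q Φ.source F T a₁ b₁ a₂ b₂)
    (hs : ∀ y ∈ Φ.source, s (Φ y) = Submodule.span ℝ {combine a₁ b₁ F T y}) {y : ℝ × ℝ}
    (hy : y ∈ Φ.source) {P : Submodule ℝ LieVec} :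
    IsAxisPlane p q s (Φ y) P ↔ P = Submodule.span ℝ
      {combine a₂ b₂ (∂₂ F) (∂₂ T) y, ∂₂ (combine a₂ b₂ (∂₂ F) (∂₂ T)) y} := by
  have hnhds : ∀ r : S → Prop, (∀ᶠ x in 𝓝 (Φ y), r x) ↔ ∀ᶠ z in 𝓝 y, r (Φ z) := fun r =>
    Φ.toOpenPartialHomeomorph.eventually_nhds r hy
  constructor
  · rintro ⟨hfin, hperp, hev⟩
    rw [hnhds] at hev
    obtain ⟨O, hO, hOo, hyO⟩ := eventually_nhds_iff.1 (hev.and (h.isOpen.eventually_mem hy))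
    refine Submodule.eq_of_le_of_finrank_eq (fun n hn => ?_)
      (by rw [hfin, h.finrank_span hp hpq hy])
    have hn₁ : ∀ z ∈ O, lieForm (combine a₁ b₁ F T z) n = 0 := by
      intro z hz
      rw [lieForm_comm]
      refine (hO z hz).1 n hn _ ?_
      rw [hs z (hO z hz).2]
      exact Submodule.mem_span_singleton_self _
    refine h.mem_span_of_perp hp hpq hy (hperp n hn).1 (hperp n hn).2 ?_ ?_
    · rw [lieForm_comm]; exact hn₁ y hyO
    · rw [lieForm_comm]
      exact lieForm_dirDeriv_eq_zero hOo (h.smooth_σ₁.mono fun z hz => (hO z hz).2) hn₁ hyO _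
  · rintro rfl
    refine ⟨h.finrank_span hp hpq hy, fun n hn =>
      ⟨(h.perp_of_mem_span hy hn).1, (h.perp_of_mem_span hy hn).2.1⟩, ?_⟩
    rw [hnhds]
    filter_upwards [h.eventually_span_eq hp hpq hy, h.isOpen.eventually_mem hy] with z hz hzD
    intro n hn m hm
    rw [← hz] at hn
    rw [hs z hzD] at hm
    obtain ⟨c, rfl⟩ := Submodule.mem_span_singleton.1 hm
    rw [map_smul, (h.perp_of_mem_span hzD hn).2.2, smul_zero]

/-- A locally unique choice of axis planes is constant on a connected surface. -/
theorem exists_isAxisPlane [ConnectedSpace S] (hex : ∀ x, ∃ P, IsAxisPlane p q s x P)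
    (huniq : ∀ x P P', IsAxisPlane p q s x P → IsAxisPlane p q s x P' → P = P') :
    ∃ P, ∀ x, IsAxisPlane p q s x P := by
  obtain ⟨x₀⟩ : Nonempty S := inferInstance
  obtain ⟨P, hP⟩ := hex x₀
  have hclopen : IsClopen {x | IsAxisPlane p q s x P} := by
    refine ⟨⟨isOpen_iff_mem_nhds.2 fun x hx => ?_⟩, isOpen_iff_mem_nhds.2 fun x hx => hx.eventually⟩
    obtain ⟨P', hP'⟩ := hex x
    filter_upwards [hP'.eventually] with y hy hyP
    exact hx (huniq y P P' hyP hy ▸ hP')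
  exact ⟨P, fun x => (hclopen.eq_univ ⟨x₀, hP⟩ ▸ mem_univ x : x ∈ {x | IsAxisPlane p q s x P})⟩

/-- A plane that carries the circular curvature lines of a chart has an orthogonal basis whose
first vector has length one. -/
theorem ChannelChart.exists_orthogonal_basis {D : Set (ℝ × ℝ)} {F T : ℝ × ℝ → LieVec}
    {a₁ b₁ a₂ b₂ : ℝ × ℝ → ℝ} (h : ChannelChart p q D F T a₁ b₁ a₂ b₂) (hp : lieForm p p = -1)
    (hpq : lieForm p q = 0) {y : ℝ × ℝ} (hy : y ∈ D) :
    ∃ e v : LieVec, Submodule.span ℝ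
        {combine a₂ b₂ (∂₂ F) (∂₂ T) y, ∂₂ (combine a₂ b₂ (∂₂ F) (∂₂ T)) y}
      = Submodule.span ℝ {e, v} ∧ lieForm e e = 1 ∧ lieForm e v = 0 ∧ v ≠ 0 := by
  have hpos := h.ω_pos hp hpq hy
  have hσ := h.lieForm_dirDeriv_ω_σ₂ hy
  have hω := h.ω_perp_σ₂ hy
  set w := combine a₂ b₂ (∂₂ F) (∂₂ T) y with hw
  set w' := ∂₂ (combine a₂ b₂ (∂₂ F) (∂₂ T)) y with hw'
  set r := √(lieForm w w) with hr
  have hr0 : r ≠ 0 := (Real.sqrt_pos.2 hpos).ne'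
  have hrr : r * r = lieForm w w := Real.mul_self_sqrt hpos.le
  set k := lieForm w w' / lieForm w w with hk
  have hkw : k * lieForm w w = lieForm w w' := div_mul_cancel₀ _ hpos.ne'
  refine ⟨r⁻¹ • w, w' - k • w, ?_, ?_, ?_, ?_⟩
  · apply le_antisymm
    · rw [Submodule.span_le]
      rintro z (rfl | rfl)
      · refine Submodule.mem_span_pair.2 ⟨r, 0, ?_⟩
        rw [smul_smul, mul_inv_cancel₀ hr0]; simp
      · refine Submodule.mem_span_pair.2 ⟨k * r, 1, ?_⟩
        rw [smul_smul, mul_assoc, mul_inv_cancel₀ hr0]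
        module
    · rw [Submodule.span_le]
      rintro z (rfl | rfl)
      · exact Submodule.mem_span_pair.2 ⟨r⁻¹, 0, by simp⟩
      · exact Submodule.mem_span_pair.2 ⟨-k, 1, by module⟩
  · simp only [map_smul, LinearMap.smul_apply, smul_eq_mul, ← hrr]
    field_simp
  · simp only [map_smul, map_sub, LinearMap.smul_apply, smul_eq_mul]
    linear_combination -r⁻¹ * hkw
  · intro h0
    have h1 := congrArg (fun z => lieForm z (combine a₂ b₂ F T y)) h0
    simp [hω, hσ, hpos.ne'] at h1

end AxisPlane

/-! ### Rotational coordinates -/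

/-- In a curvature line chart with constant axis plane, the surface is invariant under the
rotations of that plane. -/
theorem exists_rotational_coordinates {S : Type*} [TopologicalSpace S]
    [ChartedSpace (EuclideanSpace ℝ (Fin 2)) S] {p q : LieVec} {f t : S → LieVec}
    (hp : lieForm p p = -1) (hpq : lieForm p q = 0) (hf : IsSpaceFormSurface p q f t)
    (Φ : PartialDiffeomorph 𝓘(ℝ, ℝ × ℝ) (𝓡 2) (ℝ × ℝ) S ∞) {a₁ b₁ a₂ b₂ : ℝ × ℝ → ℝ}
    (h : ChannelChart p q Φ.source (fun y => f (Φ y)) (fun y => t (Φ y)) a₁ b₁ a₂ b₂)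
    {e v : LieVec} (he : lieForm e e = 1) (hev : lieForm e v = 0) (hv : v ≠ 0)
    (hspan : ∀ y ∈ Φ.source, Submodule.span ℝ
      {combine a₂ b₂ (∂₂ fun y => f (Φ y)) (∂₂ fun y => t (Φ y)) y,
        ∂₂ (combine a₂ b₂ (∂₂ fun y => f (Φ y)) (∂₂ fun y => t (Φ y))) y}
      = Submodule.span ℝ {e, v}) {y₀ : ℝ × ℝ} (hy₀ : y₀ ∈ Φ.source) :
    ∃ (Ψ : PartialDiffeomorph 𝓘(ℝ, ℝ × ℝ) (𝓡 2) (ℝ × ℝ) S ∞) (r₀ r₁ θ₀ θ₁ : ℝ)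
      (c ν : ℝ → LieVec) (e' : LieVec),
      Ψ.source = Ioo r₀ r₁ ×ˢ Ioo θ₀ θ₁ ∧ Φ y₀ ∈ Ψ.target ∧
      e' ∈ Submodule.span ℝ {e, v} ∧ lieForm e' e' = 1 ∧
      (∀ r ∈ Ioo r₀ r₁, c r ∈ spaceForm p q ∧ ν r ∈ planeSpace p q ∧ lieForm (c r) e' = 0) ∧
      ∀ r ∈ Ioo r₀ r₁, ∀ θ ∈ Ioo θ₀ θ₁,
        f (Ψ (r, θ)) = rot e v θ (c r) ∧ t (Ψ (r, θ)) = rot e v θ (ν r) := by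
  obtain ⟨e', O, θ, he', he'1, hO, hy₀O, hOD, hθ, hθ0, hθe, hθd⟩ :=
    h.exists_angle_function hp hpq he hev hv hspan hy₀
  have hGd : ∀ y ∈ O, HasFDerivAt (fun y : ℝ × ℝ => (y.1, θ y))
      ((ContinuousLinearMap.fst ℝ ℝ ℝ).prod (fderiv ℝ θ y)) y := fun y hy =>
    hasFDerivAt_fst.prodMk (hθ.diffAt hO hy).hasFDerivAt
  obtain ⟨Ψ, g, r₀, r₁, θ₀, θ₁, hsrc, hy, hgy, hgO, hgs, hGg, hΨ⟩ :=
    exists_partialDiffeomorph_of_injective (by simp) Φ hO hOD hy₀O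
      (contDiff_fst.contDiffOn.prodMk hθ) (by
        intro w hw
        rw [(hGd y₀ hy₀O).fderiv] at hw
        have h1 : w.1 = 0 := congrArg Prod.fst hw
        have h2 : dirDeriv w θ y₀ = 0 := congrArg Prod.snd hw
        rw [dirDeriv_eq, h1, zero_smul, zero_add, smul_eq_zero] at h2
        exact Prod.ext h1 (h2.resolve_right (hθd y₀ hy₀O).1))
  rw [hθ0] at hy hgy
  have h0 : (0 : ℝ) ∈ Ioo θ₀ θ₁ := hy.2
  have hBo : IsOpen (Ioo r₀ r₁ ×ˢ Ioo θ₀ θ₁) := isOpen_Ioo.prod isOpen_Ioo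
  -- The curves of constant first coordinate are orbits of the rotations.
  have horbit : ∀ m : S → LieVec, ContMDiff (𝓡 2) 𝓘(ℝ, LieVec) ∞ m →
      (∀ y ∈ O, ∂₂ (fun y => m (Φ y)) y = ∂₂ θ y • rotGen e v (m (Φ y))) →
      ∀ r ∈ Ioo r₀ r₁, ∀ s ∈ Ioo θ₀ θ₁, m (Ψ (r, s)) = rot e v s (m (Ψ (r, 0))) := by
    intro m hm hmd r hr s hs
    have hms : ContDiffOn ℝ ∞ (fun y => m (Φ y)) Φ.source :=
      (hm.comp_contMDiffOn Φ.contMDiffOn).contDiffOn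
    refine eq_rot_of_hasDerivAt (g := fun s => m (Ψ (r, s))) (fun s hs => ?_) h0 hs
    have hB : (r, s) ∈ Ioo r₀ r₁ ×ˢ Ioo θ₀ θ₁ := ⟨hr, hs⟩
    have hl : HasDerivAt (fun s : ℝ => (r, s)) ((0 : ℝ), (1 : ℝ)) s :=
      (hasDerivAt_const s r).prodMk (hasDerivAt_id s)
    have hg : HasDerivAt (fun s => g (r, s)) (∂₂ g (r, s)) s :=
      (hgs.diffAt hBo hB).hasFDerivAt.comp_hasDerivAt s hl
    have hG : HasDerivAt (fun s => ((g (r, s)).1, θ (g (r, s)))) _ s :=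
      (hGd _ (hgO hB)).comp_hasDerivAt s hg
    have hGid : (fun s => ((g (r, s)).1, θ (g (r, s)))) =ᶠ[𝓝 s] fun s => (r, s) :=
      Filter.eventuallyEq_of_mem (isOpen_Ioo.mem_nhds hs) fun z hz => hGg (r, z) ⟨hr, hz⟩
    have hd := hG.unique (hl.congr_of_eventuallyEq hGid)
    have h1 : (∂₂ g (r, s)).1 = 0 := congrArg Prod.fst hd
    have h2 : dirDeriv (∂₂ g (r, s)) θ (g (r, s)) = 1 := congrArg Prod.snd hd
    rw [dirDeriv_eq, h1, zero_smul, zero_add, smul_eq_mul] at h2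
    have hM := (hms.diffAt h.isOpen (hOD (hgO hB))).hasFDerivAt
    set M : ℝ × ℝ → LieVec := fun y => m (Φ y) with hMdef
    have hF : HasDerivAt (M ∘ fun s => g (r, s)) _ s := hM.comp_hasDerivAt s hg
    simp only [hΨ]
    refine hF.congr_deriv ?_
    change dirDeriv (∂₂ g (r, s)) M (g (r, s)) = _
    rw [dirDeriv_eq, h1, zero_smul, zero_add, hmd _ (hgO hB), smul_smul, h2, one_smul]
  have hmem0 : ∀ r ∈ Ioo r₀ r₁, (r, (0 : ℝ)) ∈ Ioo r₀ r₁ ×ˢ Ioo θ₀ θ₁ := fun r hr => ⟨hr, h0⟩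
  refine ⟨Ψ, r₀, r₁, θ₀, θ₁, fun r => f (Ψ (r, 0)), fun r => t (Ψ (r, 0)), e', hsrc, ?_, he', he'1,
    fun r hr => ⟨hf.mem_f _, hf.mem_t _, ?_⟩, fun r hr s hs =>
    ⟨horbit f hf.smooth_f (fun y hy => (hθd y hy).2.1) r hr s hs,
      horbit t hf.smooth_t (fun y hy => (hθd y hy).2.2) r hr s hs⟩⟩
  · have h1 : Ψ (y₀.1, 0) ∈ Ψ.target := Ψ.map_source (hsrc ▸ hy)
    rwa [hΨ, hgy] at h1
  · change lieForm (f (Ψ (r, 0))) e' = 0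
    rw [hΨ]
    exact hθe _ (hgO (hmem0 r hr)) (congrArg Prod.snd (hGg _ (hmem0 r hr)))

theorem mainTheorem1 {S : Type*} [TopologicalSpace S] [ConnectedSpace S]
    [ChartedSpace (EuclideanSpace ℝ (Fin 2)) S] [IsManifold (𝓡 2) ∞ S]
    (p q : LieVec) (hp : lieForm p p = -1) (hq : q ≠ 0) (hpq : lieForm p q = 0)
    (f t : S → LieVec) (hf : IsSpaceFormSurface p q f t) (humb : UmbilicFree f t)
    (hW : IsNonTubularLinearWeingarten p q f t) (hc : IsChannel f t) :
    IsRotationalSurface p q f t := by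
  obtain ⟨a, b, c, habc, hW⟩ := hW
  obtain ⟨s, hs, hloc⟩ := hc
  have hchart := fun x : S => exists_channelChart hf humb habc hW hs (hloc x)
  obtain ⟨P, hP⟩ : ∃ P, ∀ x, IsAxisPlane p q s x P := by
    refine exists_isAxisPlane (fun x => ?_) fun x P P' hP hP' => ?_
    · obtain ⟨Φ, a₁, b₁, a₂, b₂, y, hy, rfl, h, hsΦ⟩ := hchart x
      exact ⟨_, (isAxisPlane_iff hp hpq Φ h hsΦ hy).2 rfl⟩
    · obtain ⟨Φ, a₁, b₁, a₂, b₂, y, hy, rfl, h, hsΦ⟩ := hchart x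
      rw [isAxisPlane_iff hp hpq Φ h hsΦ hy] at hP hP'
      rw [hP, hP']
  obtain ⟨e, v, rfl, he, hev, hv⟩ :
      ∃ e v : LieVec, P = Submodule.span ℝ {e, v} ∧ lieForm e e = 1 ∧ lieForm e v = 0 ∧ v ≠ 0 := by
    obtain ⟨x₀⟩ : Nonempty S := inferInstance
    obtain ⟨Φ, a₁, b₁, a₂, b₂, y, hy, rfl, h, hsΦ⟩ := hchart x₀
    obtain ⟨e, v, hspan, hev⟩ := h.exists_orthogonal_basis hp hpq hy
    exact ⟨e, v, ((isAxisPlane_iff hp hpq Φ h hsΦ hy).1 (hP _)).trans hspan, hev⟩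
  obtain ⟨x₀⟩ : Nonempty S := inferInstance
  have hperp := (hP x₀).2.1
  have he_perp := hperp e (Submodule.subset_span (by simp))
  have hv_perp := hperp v (Submodule.subset_span (by simp))
  refine ⟨Submodule.span ℝ {e, v}, rot e v,
    isRotationSubgroup_rot he hev hv he_perp.1 he_perp.2 hv_perp.1 hv_perp.2, ?_, fun x => ?_⟩
  · rcases lt_trichotomy (lieForm v v) 0 with hlt | heq | hgt
    · exact Or.inr (Or.inr ⟨e, v, rfl, he, hev, hlt⟩)
    · exact Or.inr (Or.inl ⟨e, v, rfl, he, hev, heq⟩)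
    · exact Or.inl ⟨e, v, rfl, he, hev, hgt⟩
  · obtain ⟨Φ, a₁, b₁, a₂, b₂, y, hy, rfl, h, hsΦ⟩ := hchart x
    exact exists_rotational_coordinates hp hpq hf Φ h he hev hv
      (fun z hz => ((isAxisPlane_iff hp hpq Φ h hsΦ hz).1 (hP _)).symm) hy
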